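/- Let $\mathcal X,\mathcal Y,\hat{\mathcal Y}$ be measurable spaces, $\ell:\hat{\mathcal Y}\times\mathcal Y\to\mathbb R$ a measurable loss function, $\lambda>0$, and $P$ a probability distribution of $(X,Y)$ on $\mathcal X\times\mathcal Y$. A descriptor-estimator pair $(e,f)$ with common randomness consists of a random variable $W$ (on an arbitrary probability space, with a law chosen as part of the scheme) that is independent of $(X,Y)$, a measurable descriptor $e$ producing $M=e(X,W)\in\{0,1\}^*$ such that for each value $w$ of $W$ the set of strings $\{e(x,w):x\in\mathcal X\}$ is prefix-free, and a measurable estimator $f$ producing $\hat Y=f(M,W)\in\hat{\mathcal Y}$. Its risk-rate cost under $P$ is $$L_\lambda(e,f,P)=\mathbb E\big[\ell(f(M,W),Y)\big]+\lambda\,\mathbb E\big[|M|\big],$$ where $|M|$ is the length of $M$. For a set $\Gamma$ of distributions of $(X,Y)$ let $L^*_\lambda(\Gamma)=\inf_{(e,f)}\sup_{P\in\Gamma}L_\lambda(e,f,P)$. Then for $\Gamma=\{P\}$, $$L^*_\lambda(\{P\})\;\ge\;\inf_{P_{\hat Y|X}}\Big(\mathbb E[\ell(\hat Y,Y)]+\lambda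 I(X;\hat Y)\Big),$$ $$L^*_\lambda(\{P\})\;\le\;\inf_{P_{\hat Y|X}}\Big(\mathbb E[\ell(\hat Y,Y)]+\lambda\big(I(X;\hat Y)+\log_2(I(X;\hat Y)+1)+5\big)\Big).$$ Here the infima are over all conditional distributions (Markov kernels) $P_{\hat Y|X}$ from $\mathcal X$ to $\hat{\mathcal Y}$, the variables satisfy $(X,Y)\sim P$ with $\hat Y$ conditionally independent of $Y$ given $X$, and $I(X;\hat Y)\in[0,\infty]$ is the mutual information in bits. Expectations and costs take values in $[-\infty,\infty]$; a cost that is undefined (of the form $\infty-\infty$) is counted as $+\infty$, and an infimum over the empty set is $+\infty$. -/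

import Mathlib

open MeasureTheory ProbabilityTheory
open scoped ENNReal

universe u

namespace RemotePrediction

noncomputable section

/-- The expectation of a real random variable with values in `[-∞, ∞]`, that is `E[g⁺] - E[g⁻]`.
If both parts are infinite the expectation does not exist and the value is `⊤`, so that it never
contributes to an infimum. -/
def extExpectation {α : Type*} [MeasurableSpace α] (μ : Measure α) (g : α → ℝ) : EReal :=
  open Classical in
  if ∫⁻ a, ENNReal.ofReal (g a) ∂μ = ∞ ∧ ∫⁻ a, ENNReal.ofReal (-g a) ∂μ = ∞ then ⊤
  else ((∫⁻ a, ENNReal.ofReal (g a) ∂μ : ℝ≥0∞) : EReal)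
    - ((∫⁻ a, ENNReal.ofReal (-g a) ∂μ : ℝ≥0∞) : EReal)

/-- The Lagrangian `risk + lam * rate`. In the undefined case `-∞ + ∞` the value is `⊤`, so that it
never contributes to an infimum (Mathlib's `⊥ + ⊤ = ⊥` in `EReal` would). -/
def lagrangian (lam : ℝ) (risk rate : EReal) : EReal :=
  open Classical in
  if risk = ⊥ ∧ (lam : EReal) * rate = ⊤ then ⊤ else risk + (lam : EReal) * rate

/-- The logarithm to base 2 on `[0, ∞]`. -/
def log2 (x : ℝ≥0∞) : EReal := ENNReal.log x / ((Real.log 2 : ℝ) : EReal)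

/-- The mutual information, in bits, of a pair of random variables with joint law `ρ`: the
Kullback–Leibler divergence of the joint law from the product of its marginals. -/
def mutualInfo {α β : Type*} [MeasurableSpace α] [MeasurableSpace β] (ρ : Measure (α × β)) :
    ℝ≥0∞ :=
  InformationTheory.klDiv ρ (ρ.fst.prod ρ.snd) / ENNReal.ofReal (Real.log 2)

/-- A set of binary strings is prefix-free if no element is a proper prefix of another one. -/
def PrefixFree (C : Set (List Bool)) : Prop :=
  ∀ a ∈ C, ∀ b ∈ C, a <+: b → a = b

/-- A descriptor-estimator pair `(e, f)` with common randomness `W`: the description is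
`M = e(X, W) ∈ {0,1}*`, the estimate is `Ŷ = f(M, W)`, and for every value `w` of `W` the set of
descriptions in use is prefix-free (it may depend on `w`). The law of `W` is part of the scheme,
and `W` is independent of the data (see `Scheme.risk` and `Scheme.rate`). -/
structure Scheme (𝒳 𝒵 : Type u) [MeasurableSpace 𝒳] [MeasurableSpace 𝒵] where
  /-- the space in which the common randomness takes its values -/
  𝒲 : Type u
  [measurableSpace : MeasurableSpace 𝒲]
  /-- the law of the common randomness -/
  law : Measure 𝒲
  [isProbabilityMeasure : IsProbabilityMeasure law]
  /-- the descriptor `e` -/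
  desc : 𝒳 → 𝒲 → List Bool
  /-- the estimator `f` -/
  est : List Bool → 𝒲 → 𝒵
  measurableSet_desc : ∀ m : List Bool, MeasurableSet {p : 𝒳 × 𝒲 | desc p.1 p.2 = m}
  measurable_est : ∀ m : List Bool, Measurable (est m)
  prefixFree : ∀ w : 𝒲, PrefixFree (Set.range fun x : 𝒳 => desc x w)

attribute [instance] Scheme.measurableSpace Scheme.isProbabilityMeasure

variable {𝒳 𝒴 𝒵 : Type u} [MeasurableSpace 𝒳] [MeasurableSpace 𝒴] [MeasurableSpace 𝒵]

/-- The risk `E[ℓ(f(e(X, W), W), Y)]`, where `(X, Y) ∼ P` and `W` is independent of `(X, Y)`. -/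
def Scheme.risk (S : Scheme 𝒳 𝒵) (loss : 𝒵 → 𝒴 → ℝ) (P : Measure (𝒳 × 𝒴)) : EReal :=
  extExpectation (P.prod S.law) fun q => loss (S.est (S.desc q.1.1 q.2) q.2) q.1.2

/-- The rate `E[|e(X, W)|]`, where `(X, Y) ∼ P` and `W` is independent of `(X, Y)`. -/
def Scheme.rate (S : Scheme 𝒳 𝒵) (P : Measure (𝒳 × 𝒴)) : ℝ≥0∞ :=
  ∫⁻ q, ((S.desc q.1.1 q.2).length : ℝ≥0∞) ∂(P.prod S.law)

/-- The risk-rate Lagrangian cost of a descriptor-estimator pair. -/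
def Scheme.cost (S : Scheme 𝒳 𝒵) (loss : 𝒵 → 𝒴 → ℝ) (lam : ℝ) (P : Measure (𝒳 × 𝒴)) : EReal :=
  lagrangian lam (S.risk loss P) (S.rate P : EReal)

/-- The minimax risk-rate cost over an ambiguity set `Γ` of laws of `(X, Y)`. -/
def minimaxCost (loss : 𝒵 → 𝒴 → ℝ) (lam : ℝ) (Γ : Set (ProbabilityMeasure (𝒳 × 𝒴))) : EReal :=
  ⨅ S : Scheme 𝒳 𝒵, ⨆ P ∈ Γ, S.cost loss lam (P : Measure (𝒳 × 𝒴))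

/-- `E[ℓ(Ŷ, Y)]`, where `(X, Y) ∼ P` and, given `(X, Y)`, `Ŷ` has law `κ X` (so `Y → X → Ŷ` is a
Markov chain). -/
def channelRisk (κ : Kernel 𝒳 𝒵) (loss : 𝒵 → 𝒴 → ℝ) (P : Measure (𝒳 × 𝒴)) : EReal :=
  extExpectation (P ⊗ₘ (κ.comap Prod.fst measurable_fst : Kernel (𝒳 × 𝒴) 𝒵))
    fun q => loss q.2 q.1.2

/-- `I(X; Ŷ)` in bits, where `(X, Y) ∼ P` and `Ŷ` has conditional law `κ` given `X`. -/
def channelInfo (κ : Kernel 𝒳 𝒵) (P : Measure (𝒳 × 𝒴)) : ℝ≥0∞ :=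
  mutualInfo (P.fst ⊗ₘ κ)

end

end RemotePrediction

open RemotePrediction

/-!
Both bounds compare a scheme with the channel from the observation `X` to the estimate `Ŷ` that it
induces; the risk of a scheme is the risk of its channel (`Scheme.risk_eq_channelRisk`).

*Lower bound.* Let `X'` be drawn from the conditional law of `X` given the description `M` and the
common randomness `W`. Since `X'` yields the same description as `X`, the pair formed by `X` and the
estimate computed from `(X', W)` has the joint law of `(X, Ŷ)`, and if instead `X'` is independent
of `(X, W)` it has the product of the marginals. The divergence between the two laws of `(X, W, X')`
is the conditional entropy of `M` given `W`, so data processing bounds `I(X; Ŷ)` by this entropy,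
which is at most `E|M|` by Kraft's inequality. The space of triples carries an explicit density, so
that no measure on the strings and no disintegration is needed
(`Scheme.channelInfo_channel_le_rate`).

*Upper bound.* Given a channel of finite information, let `Q` be its output law and `r` the density
of the joint law with respect to the product of its marginals. For a fixed input, greedy rejection
sampling draws independent proposals from `Q` and cuts the region under the graph of `r` into
horizontal layers, from `level i` to `level (i + 1)`, whose thickness is the mass not yet covered.
Round `i` accepts so as to output exactly the part of the target in layer `i`
(`proposalLaw_firstAccept_add`), hence the output law is exact (`proposalLaw_output`).

The index `K` of the accepted proposal, counted from `0`, is distributed as the index of the layer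
of a uniform point under the graph of `r`. Let `U` be the height of that point and `F` the
distribution function of `U`. As the layers get thinner, `K (1 - F(U)) ≤ U`; moreover `F(u) ≤ u`.
Together these give `(K + 1) F(U) (1 - F(U)) ≤ U`. Now `F(U)` is uniform, so `-log F(U)` and
`-log (1 - F(U))` have expectation `1`, and `E log U = D - 1` where `D` is the divergence of the
target from `Q`. Therefore `E log (K + 1) ≤ D + 1` in nats (`tsum_log_mul_layer_le`), which is
`I + 1 / log 2` bits after averaging over the input. The index is described by a prefix code that
writes the bit length of `K + 1` in a Rice code followed by the remaining bits (`riceCode`). With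
`2 ^ j ≤ I + 1 < 2 ^ (j + 1)` the expected length is at most `I + log₂ (I + 1) + 5`
(`exists_riceCode_parameter`).
-/

open MeasureTheory ProbabilityTheory
open scoped ENNReal

namespace RemotePrediction

/-! ### Lagrangian, expectation and the channel of a scheme -/

theorem lagrangian_mono {lam : ℝ} (hlam : 0 < lam) (risk : EReal) {a b : EReal} (h : a ≤ b) :
    lagrangian lam risk a ≤ lagrangian lam risk b := by
  have hab : (lam : EReal) * a ≤ lam * b :=
    mul_le_mul_of_nonneg_left h (by exact_mod_cast hlam.le)
  unfold lagrangian
  by_cases hb : risk = ⊥ ∧ (lam : EReal) * b = ⊤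
  · rw [if_pos hb]
    exact le_top
  · have ha : ¬(risk = ⊥ ∧ (lam : EReal) * a = ⊤) :=
      fun ha => hb ⟨ha.1, top_le_iff.mp (ha.2 ▸ hab)⟩
    rw [if_neg ha, if_neg hb]
    gcongr

theorem extExpectation_map {α β : Type*} [MeasurableSpace α] [MeasurableSpace β] (μ : Measure α)
    {h : α → β} (hh : Measurable h) {g : β → ℝ} (hg : Measurable g) :
    extExpectation (μ.map h) g = extExpectation μ fun a => g (h a) := by
  unfold extExpectation
  rw [lintegral_map hg.ennreal_ofReal hh,
    lintegral_map (f := fun a => ENNReal.ofReal (-g a)) hg.neg.ennreal_ofReal hh]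

namespace Scheme

variable {𝒳 𝒴 𝒵 : Type u} [MeasurableSpace 𝒳] [MeasurableSpace 𝒴] [MeasurableSpace 𝒵]

/-- The estimate `Ŷ = f(e(x, w), w)` as a function of the observation and the common
randomness. -/
def output (S : Scheme 𝒳 𝒵) (p : 𝒳 × S.𝒲) : 𝒵 := S.est (S.desc p.1 p.2) p.2

theorem measurable_output (S : Scheme 𝒳 𝒵) : Measurable S.output := by
  intro C hC
  have : S.output ⁻¹' C
      = ⋃ m : List Bool, {p : 𝒳 × S.𝒲 | S.desc p.1 p.2 = m} ∩ {p | S.est m p.2 ∈ C} := by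
    ext p
    simp [output]
  rw [this]
  exact MeasurableSet.iUnion fun m => (S.measurableSet_desc m).inter
    (((S.measurable_est m).comp measurable_snd) hC)

/-- The conditional law of the estimate given the observation that a scheme induces. -/
noncomputable def channel (S : Scheme 𝒳 𝒵) : Kernel 𝒳 𝒵 where
  toFun x := S.law.map fun w => S.output (x, w)
  measurable' := by
    refine Measure.measurable_of_measurable_coe _ fun C hC => ?_
    have : ∀ x, (S.law.map fun w => S.output (x, w)) C
        = S.law (Prod.mk x ⁻¹' (S.output ⁻¹' C)) := fun x =>
      Measure.map_apply (S.measurable_output.comp measurable_prodMk_left) hC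
    simp_rw [this]
    exact measurable_measure_prodMk_left (S.measurable_output hC)

theorem channel_apply (S : Scheme 𝒳 𝒵) (x : 𝒳) {C : Set 𝒵} (hC : MeasurableSet C) :
    S.channel x C = S.law {w | S.output (x, w) ∈ C} :=
  Measure.map_apply (S.measurable_output.comp measurable_prodMk_left) hC

instance (S : Scheme 𝒳 𝒵) : IsMarkovKernel S.channel :=
  ⟨fun _ => Measure.isProbabilityMeasure_map
    (S.measurable_output.comp measurable_prodMk_left).aemeasurable⟩

theorem map_prod_law (S : Scheme 𝒳 𝒵) (P : Measure (𝒳 × 𝒴)) [IsProbabilityMeasure P] :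
    (P.prod S.law).map (fun q => (q.1, S.output (q.1.1, q.2)))
      = P ⊗ₘ (S.channel.comap Prod.fst measurable_fst : Kernel (𝒳 × 𝒴) 𝒵) := by
  have hm : Measurable fun q : (𝒳 × 𝒴) × S.𝒲 => (q.1, S.output (q.1.1, q.2)) :=
    measurable_fst.prodMk (S.measurable_output.comp
      ((measurable_fst.comp measurable_fst).prodMk measurable_snd))
  ext s hs
  rw [Measure.map_apply hm hs, Measure.prod_apply (hm hs), Measure.compProd_apply hs]
  refine lintegral_congr fun p => ?_
  rw [Kernel.comap_apply, S.channel_apply _ (measurable_prodMk_left hs)]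
  rfl

theorem risk_eq_channelRisk (S : Scheme 𝒳 𝒵) {loss : 𝒵 → 𝒴 → ℝ}
    (hloss : Measurable (Function.uncurry loss)) (P : Measure (𝒳 × 𝒴)) [IsProbabilityMeasure P] :
    S.risk loss P = channelRisk S.channel loss P := by
  have hm : Measurable fun q : (𝒳 × 𝒴) × S.𝒲 => (q.1, S.output (q.1.1, q.2)) :=
    measurable_fst.prodMk (S.measurable_output.comp
      ((measurable_fst.comp measurable_fst).prodMk measurable_snd))
  have hg : Measurable fun q : (𝒳 × 𝒴) × 𝒵 => loss q.2 q.1.2 :=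
    hloss.comp (measurable_snd.prodMk (measurable_snd.comp measurable_fst))
  rw [channelRisk, ← map_prod_law, extExpectation_map _ hm hg]
  rfl

end Scheme

/-! ### Kraft's inequality and the entropy of a prefix-free description -/

theorem PrefixFree.mono {C D : Set (List Bool)} (hD : PrefixFree D) (h : C ⊆ D) : PrefixFree C :=
  fun a ha b hb => hD a (h ha) b (h hb)

theorem PrefixFree.uniquelyDecodable {C : Set (List Bool)} (hC : PrefixFree C) (hnil : [] ∉ C) :
    InformationTheory.UniquelyDecodable C := by
  intro L₁
  induction L₁ with
  | nil =>
    intro L₂ _ h₂ h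
    cases L₂ with
    | nil => rfl
    | cons b L₂ =>
      simp only [List.flatten_nil, List.flatten_cons, List.nil_eq, List.append_eq_nil_iff] at h
      exact absurd (h.1 ▸ h₂ b (by simp)) hnil
  | cons a L₁ ih =>
    intro L₂ h₁ h₂ h
    cases L₂ with
    | nil =>
      simp only [List.flatten_nil, List.flatten_cons, List.append_eq_nil_iff] at h
      exact absurd (h.1 ▸ h₁ a (by simp)) hnil
    | cons b L₂ =>
      simp only [List.flatten_cons] at h
      have ha := h₁ a (by simp)
      have hb := h₂ b (by simp)
      have hab : a = b := by
        rcases List.prefix_or_prefix_of_prefix (List.prefix_append a L₁.flatten)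
          (h ▸ List.prefix_append b L₂.flatten) with hp | hp
        · exact hC a ha b hb hp
        · exact (hC b hb a ha hp).symm
      subst hab
      rw [ih L₂ (fun w hw => h₁ w (by simp [hw])) (fun w hw => h₂ w (by simp [hw]))
        (List.append_cancel_left h)]

/-- Kraft's inequality. The case of the code `{[]}`, which is prefix-free but not uniquely
decodable, is separate. -/
theorem PrefixFree.tsum_le_one {C : Set (List Bool)} (hC : PrefixFree C) :
    ∑' m : C, (2⁻¹ : ℝ≥0∞) ^ (m : List Bool).length ≤ 1 := by
  by_cases hnil : [] ∈ C
  · have : C = {[]} := by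
      ext a
      refine ⟨fun ha => (hC [] hnil a ha List.nil_prefix).symm, ?_⟩
      rintro rfl
      exact hnil
    subst this
    simp
  · rw [ENNReal.tsum_eq_iSup_sum]
    refine iSup_le fun s => ?_
    have hs : PrefixFree (s.map (Function.Embedding.subtype _) : Finset (List Bool)) :=
      hC.mono (by intro a ha; simp at ha; exact ha.1)
    have hk := InformationTheory.kraft_mcmillan_inequality
      (hs.uniquelyDecodable (by simp [hnil]))
    rw [Finset.sum_map] at hk
    have := ENNReal.ofReal_le_ofReal hk
    rw [ENNReal.ofReal_sum_of_nonneg (fun _ _ => by positivity)] at this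
    simpa [ENNReal.ofReal_pow, ENNReal.ofReal_inv_of_pos, ENNReal.inv_pow] using this

theorem lintegral_comp_eq_tsum {α ι : Type*} [MeasurableSpace α] [Countable ι] (μ : Measure α)
    {e : α → ι} (he : ∀ i, MeasurableSet {x | e x = i}) (g : ι → ℝ≥0∞) :
    ∫⁻ x, g (e x) ∂μ = ∑' i, g i * μ {x | e x = i} := by
  let _ : MeasurableSpace ι := ⊤
  have hem : Measurable e := measurable_to_countable' he
  have hg : Measurable g := measurable_from_top
  rw [← lintegral_map hg hem, lintegral_countable']
  refine tsum_congr fun i => ?_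
  rw [Measure.map_apply hem trivial]
  rfl

theorem ae_measure_fiber_ne_zero {α ι : Type*} [MeasurableSpace α] [Countable ι] (μ : Measure α)
    (e : α → ι) : ∀ᵐ x ∂μ, μ {y | e y = e x} ≠ 0 := by
  rw [ae_iff]
  refine measure_mono_null (t := ⋃ m ∈ {m | μ {y | e y = m} = 0}, {x | e x = m})
    (fun x hx => ?_) ?_
  · simpa using hx
  · exact (measure_biUnion_null_iff (Set.to_countable _)).mpr fun m hm => hm

/-- A prefix-free description is on average at least as long as its entropy. This is Gibbs'
inequality `log t ≤ t - 1` for the ratio of the weights `2 ^ (-|m|)` to the probabilities,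
combined with Kraft's inequality. -/
theorem lintegral_neg_log_le_length {α : Type*} [MeasurableSpace α] (μ : Measure α)
    [IsProbabilityMeasure μ] {e : α → List Bool} (he : ∀ m, MeasurableSet {x | e x = m})
    (hpf : PrefixFree (Set.range e)) :
    ∫⁻ x, ENNReal.ofReal (-Real.log (μ {y | e y = e x}).toReal) ∂μ
      ≤ ENNReal.ofReal (Real.log 2) * ∫⁻ x, ((e x).length : ℝ≥0∞) ∂μ := by
  have hme : ∀ g : List Bool → ℝ≥0∞, Measurable fun x => g (e x) := fun g => by
    let _ : MeasurableSpace (List Bool) := ⊤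
    exact (measurable_from_top (f := g)).comp (measurable_to_countable' he)
  set q : List Bool → ℝ≥0∞ := fun m => μ {y | e y = m} with hq
  have hpos : ∀ᵐ x ∂μ, q (e x) ≠ 0 := ae_measure_fiber_ne_zero μ e
  have hK : ∫⁻ x, 2⁻¹ ^ (e x).length / q (e x) ∂μ ≤ 1 := by
    rw [lintegral_comp_eq_tsum μ he fun m => 2⁻¹ ^ m.length / q m]
    refine le_trans ?_ hpf.tsum_le_one
    rw [tsum_subtype (Set.range e) fun m => (2⁻¹ : ℝ≥0∞) ^ m.length]
    refine ENNReal.tsum_le_tsum fun m => ?_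
    by_cases hm : m ∈ Set.range e
    · rw [Set.indicator_of_mem hm]
      exact ENNReal.mul_le_of_le_div le_rfl
    · have : {x | e x = m} = ∅ := by
        ext x
        simp only [Set.mem_ofPred_eq, Set.mem_empty_iff_false, iff_false]
        rintro rfl
        exact hm ⟨x, rfl⟩
      simp [this]
  have hpt : ∀ᵐ x ∂μ, ENNReal.ofReal (-Real.log (q (e x)).toReal) + 1
      ≤ ENNReal.ofReal (Real.log 2) * ((e x).length : ℝ≥0∞)
        + 2⁻¹ ^ (e x).length / q (e x) := by
    filter_upwards [hpos] with x hx
    have hq1 : q (e x) ≤ 1 := prob_le_one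
    have hqt : q (e x) ≠ ∞ := ne_top_of_le_ne_top ENNReal.one_ne_top hq1
    set p := (q (e x)).toReal with hp
    have hp0 : 0 < p := ENNReal.toReal_pos hx hqt
    have hp1 : p ≤ 1 := by
      rw [hp, ← ENNReal.toReal_one]; exact ENNReal.toReal_mono ENNReal.one_ne_top hq1
    have hl : 0 ≤ -Real.log p := neg_nonneg.mpr (Real.log_nonpos hp0.le hp1)
    have h2 : (2⁻¹ : ℝ≥0∞) ^ (e x).length / q (e x)
        = ENNReal.ofReal ((2⁻¹) ^ (e x).length / p) := by
      rw [ENNReal.ofReal_div_of_pos hp0, ENNReal.ofReal_pow (by norm_num),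
        ENNReal.ofReal_inv_of_pos (by norm_num), hp, ENNReal.ofReal_toReal hqt]
      simp
    have h2log : 0 ≤ Real.log 2 := Real.log_nonneg (by norm_num)
    rw [h2, ← ENNReal.ofReal_one, ← ENNReal.ofReal_add hl zero_le_one,
      ← ENNReal.ofReal_natCast, ← ENNReal.ofReal_mul h2log,
      ← ENNReal.ofReal_add (by positivity) (by positivity)]
    refine ENNReal.ofReal_le_ofReal ?_
    have := Real.log_le_sub_one_of_pos (x := (2⁻¹) ^ (e x).length / p) (by positivity)
    rw [Real.log_div (by positivity) hp0.ne', Real.log_pow, Real.log_inv] at this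
    linarith
  have hint := lintegral_mono_ae hpt
  rw [lintegral_add_right _ measurable_const, lintegral_add_left
    (hme fun m => ENNReal.ofReal (Real.log 2) * (m.length : ℝ≥0∞)),
    lintegral_const_mul _ (hme fun m => (m.length : ℝ≥0∞))] at hint
  simp only [lintegral_const, measure_univ, mul_one] at hint
  exact (ENNReal.add_le_add_iff_right ENNReal.one_ne_top).mp (hint.trans (by gcongr))

/-! ### The information conveyed by a scheme -/

namespace Scheme

variable {𝒳 𝒴 𝒵 : Type u} [MeasurableSpace 𝒳] [MeasurableSpace 𝒴] [MeasurableSpace 𝒵]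

/-- The event that a second observation `x'` has the same description as `x`, given `w`. -/
def sameDesc (S : Scheme 𝒳 𝒵) : Set ((𝒳 × S.𝒲) × 𝒳) :=
  {t | S.desc t.2 t.1.2 = S.desc t.1.1 t.1.2}

theorem measurableSet_sameDesc (S : Scheme 𝒳 𝒵) : MeasurableSet S.sameDesc := by
  have : S.sameDesc = ⋃ m : List Bool,
      {t | S.desc t.2 t.1.2 = m} ∩ {t | S.desc t.1.1 t.1.2 = m} := by
    ext t
    simp [sameDesc, eq_comm]
  rw [this]
  exact MeasurableSet.iUnion fun m =>
    ((measurable_snd.prodMk (measurable_snd.comp measurable_fst)) (S.measurableSet_desc m)).inter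
      (measurable_fst (S.measurableSet_desc m))

/-- The probability of the description of `x` given the common randomness `w`, when the
observation has law `μ`. -/
noncomputable def descProb (S : Scheme 𝒳 𝒵) (μ : Measure 𝒳) (p : 𝒳 × S.𝒲) : ℝ≥0∞ :=
  μ {y | S.desc y p.2 = S.desc p.1 p.2}

theorem measurable_descProb (S : Scheme 𝒳 𝒵) (μ : Measure 𝒳) [SFinite μ] :
    Measurable (S.descProb μ) :=
  measurable_measure_prodMk_left S.measurableSet_sameDesc

theorem ae_descProb_ne_zero (S : Scheme 𝒳 𝒵) (μ : Measure 𝒳) [SFinite μ] :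
    ∀ᵐ p ∂(μ.prod S.law), S.descProb μ p ≠ 0 := by
  have hms : MeasurableSet {p : 𝒳 × S.𝒲 | ¬ S.descProb μ p ≠ 0} := by
    have := S.measurable_descProb μ (measurableSet_singleton 0)
    simp only [not_not]
    exact this
  rw [ae_iff, Measure.prod_apply_symm hms, lintegral_eq_zero_iff' ?_]
  · exact Filter.Eventually.of_forall fun w =>
      ae_iff.mp (ae_measure_fiber_ne_zero μ fun x => S.desc x w)
  · exact (measurable_measure_prodMk_right hms).aemeasurable

/-- The density, with respect to the law of `(X, W, X')` with three independent components, of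
the law under which `X'` is resampled from the conditional law of `X` given `(M, W)`. -/
noncomputable def resampleDensity (S : Scheme 𝒳 𝒵) (μ : Measure 𝒳) :
    (𝒳 × S.𝒲) × 𝒳 → ℝ≥0∞ :=
  S.sameDesc.indicator fun t => (S.descProb μ t.1)⁻¹

theorem measurable_resampleDensity (S : Scheme 𝒳 𝒵) (μ : Measure 𝒳) [SFinite μ] :
    Measurable (S.resampleDensity μ) :=
  ((S.measurable_descProb μ).comp measurable_fst).inv.indicator S.measurableSet_sameDesc

theorem map_resample (S : Scheme 𝒳 𝒵) (μ : Measure 𝒳) [IsProbabilityMeasure μ] :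
    (((μ.prod S.law).prod μ).withDensity (S.resampleDensity μ)).map
      (fun t => (t.1.1, S.output (t.2, t.1.2))) = μ ⊗ₘ S.channel := by
  have hg : Measurable fun t : (𝒳 × S.𝒲) × 𝒳 => (t.1.1, S.output (t.2, t.1.2)) :=
    (measurable_fst.comp measurable_fst).prodMk (S.measurable_output.comp
      (measurable_snd.prodMk (measurable_snd.comp measurable_fst)))
  have hg' : Measurable fun p : 𝒳 × S.𝒲 => (p.1, S.output p) :=
    measurable_fst.prodMk S.measurable_output
  ext s hs
  rw [Measure.map_apply hg hs, withDensity_apply _ (hg hs), ← lintegral_indicator (hg hs),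
    lintegral_prod _ ((S.measurable_resampleDensity μ).indicator (hg hs)).aemeasurable,
    Measure.compProd_apply hs]
  have hinner : ∀ᵐ p ∂(μ.prod S.law), ∫⁻ y, ((fun t : (𝒳 × S.𝒲) × 𝒳 =>
      (t.1.1, S.output (t.2, t.1.2))) ⁻¹' s).indicator (S.resampleDensity μ) (p, y) ∂μ
      = ((fun p : 𝒳 × S.𝒲 => (p.1, S.output p)) ⁻¹' s).indicator 1 p := by
    filter_upwards [S.ae_descProb_ne_zero μ] with p hp
    have hpt : S.descProb μ p ≠ ∞ := measure_ne_top _ _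
    -- on `sameDesc` the estimates computed from `x` and from `x'` agree
    have hpoint : ∀ y, ((fun t : (𝒳 × S.𝒲) × 𝒳 =>
        (t.1.1, S.output (t.2, t.1.2))) ⁻¹' s).indicator (S.resampleDensity μ) (p, y)
        = ((fun p : 𝒳 × S.𝒲 => (p.1, S.output p)) ⁻¹' s).indicator 1 p
          * (Prod.mk p ⁻¹' S.sameDesc).indicator (fun _ => (S.descProb μ p)⁻¹) y := by
      intro y
      by_cases hy : (p, y) ∈ S.sameDesc
      · have hout : S.output (y, p.2) = S.output p := by
          have : S.desc y p.2 = S.desc p.1 p.2 := hy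
          simp [output, this]
        have hy' : y ∈ Prod.mk p ⁻¹' S.sameDesc := hy
        have hiff : (p, y) ∈ (fun t : (𝒳 × S.𝒲) × 𝒳 => (t.1.1, S.output (t.2, t.1.2))) ⁻¹' s
            ↔ p ∈ (fun p : 𝒳 × S.𝒲 => (p.1, S.output p)) ⁻¹' s := by
          change (p.1, S.output (y, p.2)) ∈ s ↔ (p.1, S.output p) ∈ s
          rw [hout]
        simp only [Set.indicator, resampleDensity, hy, hy', if_true, Pi.one_apply, ite_mul, one_mul,
          zero_mul]
        congr 1
        exact propext hiff
      · simp [Set.indicator, resampleDensity, hy]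
    simp_rw [hpoint]
    have hms := measurable_prodMk_left (x := p) S.measurableSet_sameDesc
    rw [lintegral_const_mul _ (measurable_const.indicator hms),
      lintegral_indicator_const hms]
    have : μ (Prod.mk p ⁻¹' S.sameDesc) = S.descProb μ p := rfl
    rw [this, ENNReal.inv_mul_cancel hp hpt, mul_one]
  rw [lintegral_congr_ae hinner, lintegral_indicator_one (hg' hs), Measure.prod_apply (hg' hs)]
  refine lintegral_congr fun x => ?_
  rw [S.channel_apply _ (measurable_prodMk_left hs)]
  rfl

theorem map_independent (S : Scheme 𝒳 𝒵) (μ : Measure 𝒳) [IsProbabilityMeasure μ] :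
    ((μ.prod S.law).prod μ).map (fun t => (t.1.1, S.output (t.2, t.1.2)))
      = μ.prod (μ ⊗ₘ S.channel).snd := by
  have hg : Measurable fun t : (𝒳 × S.𝒲) × 𝒳 => (t.1.1, S.output (t.2, t.1.2)) :=
    (measurable_fst.comp measurable_fst).prodMk (S.measurable_output.comp
      (measurable_snd.prodMk (measurable_snd.comp measurable_fst)))
  have : IsProbabilityMeasure
      (((μ.prod S.law).prod μ).map (fun t => (t.1.1, S.output (t.2, t.1.2)))) :=
    Measure.isProbabilityMeasure_map hg.aemeasurable
  refine Measure.ext_prod fun {A C} hA hC => ?_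
  rw [Measure.map_apply hg (hA.prod hC), Measure.prod_prod, Measure.snd_apply hC,
    Measure.compProd_apply (measurable_snd hC), Measure.prod_apply (hg (hA.prod hC))]
  have hpre : ∀ p : 𝒳 × S.𝒲, μ (Prod.mk p ⁻¹' ((fun t : (𝒳 × S.𝒲) × 𝒳 =>
      (t.1.1, S.output (t.2, t.1.2))) ⁻¹' A ×ˢ C))
      = A.indicator 1 p.1 * μ ((fun x => (x, p.2)) ⁻¹' (S.output ⁻¹' C)) := by
    intro p
    by_cases hp : p.1 ∈ A
    · simp only [Set.indicator_of_mem hp, Pi.one_apply, one_mul]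
      congr 1
      ext y
      simp [hp]
    · simp only [Set.indicator_of_notMem hp, zero_mul]
      convert measure_empty (μ := μ)
      ext y
      simp [hp]
  simp_rw [hpre]
  rw [lintegral_prod_mul (f := A.indicator 1)
    (g := fun w => μ ((fun x => (x, w)) ⁻¹' (S.output ⁻¹' C)))
    (measurable_one.indicator hA).aemeasurable
    (measurable_measure_prodMk_right (S.measurable_output hC)).aemeasurable,
    lintegral_indicator_one hA, ← Measure.prod_apply_symm (S.measurable_output hC),
    Measure.prod_apply (S.measurable_output hC)]
  congr 1
  refine lintegral_congr fun x => ?_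
  exact (S.channel_apply x hC).symm

theorem lintegral_klFun_resampleDensity (S : Scheme 𝒳 𝒵) (μ : Measure 𝒳)
    [IsProbabilityMeasure μ] (p : 𝒳 × S.𝒲) (hp : S.descProb μ p ≠ 0) :
    ∫⁻ y, ENNReal.ofReal (InformationTheory.klFun (S.resampleDensity μ (p, y)).toReal) ∂μ
      = ENNReal.ofReal (-Real.log (S.descProb μ p).toReal) := by
  have hp1 : S.descProb μ p ≤ 1 := prob_le_one
  have hpt : S.descProb μ p ≠ ∞ := ne_top_of_le_ne_top ENNReal.one_ne_top hp1
  have hms := measurable_prodMk_left (x := p) S.measurableSet_sameDesc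
  set n := (S.descProb μ p).toReal with hn
  have hn0 : 0 < n := ENNReal.toReal_pos hp hpt
  have hn1 : n ≤ 1 := by
    rw [hn, ← ENNReal.toReal_one]; exact ENNReal.toReal_mono ENNReal.one_ne_top hp1
  have hpn : S.descProb μ p = ENNReal.ofReal n := (ENNReal.ofReal_toReal hpt).symm
  have hpoint : ∀ y, ENNReal.ofReal
      (InformationTheory.klFun (S.resampleDensity μ (p, y)).toReal)
      = (Prod.mk p ⁻¹' S.sameDesc).indicator
          (fun _ => ENNReal.ofReal (InformationTheory.klFun n⁻¹)) y
        + (Prod.mk p ⁻¹' S.sameDesc)ᶜ.indicator (fun _ => 1) y := by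
    intro y
    by_cases hy : (p, y) ∈ S.sameDesc
    · simp [Set.indicator, resampleDensity, hy, hn]
    · simp [Set.indicator, resampleDensity, hy, InformationTheory.klFun_zero]
  simp_rw [hpoint]
  rw [lintegral_add_left (measurable_const.indicator hms), lintegral_indicator_const hms,
    lintegral_indicator_const hms.compl, prob_compl_eq_one_sub hms]
  have : μ (Prod.mk p ⁻¹' S.sameDesc) = ENNReal.ofReal n := hpn
  have hkl : 0 ≤ InformationTheory.klFun n⁻¹ := InformationTheory.klFun_nonneg (by positivity)
  rw [this, ← ENNReal.ofReal_one, ← ENNReal.ofReal_sub _ hn0.le, ← ENNReal.ofReal_mul hkl,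
    ← ENNReal.ofReal_mul zero_le_one, ← ENNReal.ofReal_add (by positivity) (by linarith)]
  congr 1
  rw [InformationTheory.klFun_apply, Real.log_inv]
  field_simp
  ring

theorem measurable_length_desc (S : Scheme 𝒳 𝒵) :
    Measurable fun p : 𝒳 × S.𝒲 => ((S.desc p.1 p.2).length : ℝ≥0∞) := by
  let _ : MeasurableSpace (List Bool) := ⊤
  exact (measurable_from_top (f := fun m : List Bool => (m.length : ℝ≥0∞))).comp
    (measurable_to_countable' S.measurableSet_desc)

theorem rate_eq_lintegral (S : Scheme 𝒳 𝒵) (P : Measure (𝒳 × 𝒴)) [IsProbabilityMeasure P] :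
    S.rate P = ∫⁻ x, ∫⁻ w, ((S.desc x w).length : ℝ≥0∞) ∂S.law ∂P.fst := by
  have hl := S.measurable_length_desc
  have hl' : Measurable fun q : (𝒳 × 𝒴) × S.𝒲 => ((S.desc q.1.1 q.2).length : ℝ≥0∞) :=
    hl.comp ((measurable_fst.comp measurable_fst).prodMk measurable_snd)
  rw [rate, lintegral_prod _ hl'.aemeasurable, Measure.fst,
    lintegral_map hl.lintegral_prod_right' measurable_fst]

/-- The converse bound: the estimate of a scheme carries at most as much information about the
observation as the expected description length. -/
theorem channelInfo_channel_le_rate (S : Scheme 𝒳 𝒵) (P : Measure (𝒳 × 𝒴))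
    [IsProbabilityMeasure P] : channelInfo S.channel P ≤ S.rate P := by
  set μ := P.fst with hμ
  have hg : Measurable fun t : (𝒳 × S.𝒲) × 𝒳 => (t.1.1, S.output (t.2, t.1.2)) :=
    (measurable_fst.comp measurable_fst).prodMk (S.measurable_output.comp
      (measurable_snd.prodMk (measurable_snd.comp measurable_fst)))
  set Q := (μ.prod S.law).prod μ with hQ
  set R := Q.withDensity (S.resampleDensity μ) with hR
  have hRfin : IsFiniteMeasure R := by
    have h := S.map_resample μ
    refine ⟨?_⟩
    have hu : R Set.univ = (μ ⊗ₘ S.channel) Set.univ := by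
      rw [← h, Measure.map_apply hg MeasurableSet.univ]
      rfl
    rw [hu]
    exact measure_lt_top _ _
  have hdm := S.measurable_resampleDensity μ
  have hkl : InformationTheory.klDiv (μ ⊗ₘ S.channel) (μ.prod (μ ⊗ₘ S.channel).snd)
      ≤ ENNReal.ofReal (Real.log 2) * S.rate P := by
    calc InformationTheory.klDiv (μ ⊗ₘ S.channel) (μ.prod (μ ⊗ₘ S.channel).snd)
        ≤ InformationTheory.klDiv R Q := by
          rw [← S.map_independent μ, ← S.map_resample μ]
          exact InformationTheory.klDiv_map_le _ _ hg
      _ = ∫⁻ t, ENNReal.ofReal (InformationTheory.klFun (S.resampleDensity μ t).toReal) ∂Q := by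
          rw [InformationTheory.klDiv_eq_lintegral_klFun_of_ac
            (withDensity_absolutelyContinuous _ _)]
          refine lintegral_congr_ae ?_
          filter_upwards [Measure.rnDeriv_withDensity Q hdm] with t ht
          rw [ht]
      _ = ∫⁻ p, ENNReal.ofReal (-Real.log (S.descProb μ p).toReal) ∂(μ.prod S.law) := by
          have hm : Measurable fun t =>
              ENNReal.ofReal (InformationTheory.klFun (S.resampleDensity μ t).toReal) :=
            (InformationTheory.measurable_klFun.comp hdm.ennreal_toReal).ennreal_ofReal
          rw [hQ, lintegral_prod _ hm.aemeasurable]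
          refine lintegral_congr_ae ?_
          filter_upwards [S.ae_descProb_ne_zero μ] with p hp
          exact S.lintegral_klFun_resampleDensity μ p hp
      _ = ∫⁻ w, ∫⁻ x, ENNReal.ofReal (-Real.log (S.descProb μ (x, w)).toReal) ∂μ ∂S.law :=
          lintegral_prod_symm _ ((Real.measurable_log.comp
            (S.measurable_descProb μ).ennreal_toReal).neg.ennreal_ofReal.aemeasurable)
      _ ≤ ∫⁻ w, ENNReal.ofReal (Real.log 2)
            * ∫⁻ x, ((S.desc x w).length : ℝ≥0∞) ∂μ ∂S.law := by
          refine lintegral_mono fun w => ?_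
          exact lintegral_neg_log_le_length μ (e := fun x => S.desc x w)
            (fun m => (measurable_prodMk_right (y := w)) (S.measurableSet_desc m))
            (S.prefixFree w)
      _ = ENNReal.ofReal (Real.log 2) * S.rate P := by
          have hl := S.measurable_length_desc
          rw [lintegral_const_mul' _ _ ENNReal.ofReal_ne_top, ← lintegral_prod_symm
            (fun p : 𝒳 × S.𝒲 => ((S.desc p.1 p.2).length : ℝ≥0∞)) hl.aemeasurable,
            lintegral_prod _ hl.aemeasurable, rate_eq_lintegral]
  rw [channelInfo, mutualInfo, Measure.fst_compProd]
  exact ENNReal.div_le_of_le_mul (by rwa [mul_comm])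

end Scheme

/-- The lower bound on the minimax cost for a known law. -/
theorem iInf_lagrangian_le_minimaxCost {𝒳 𝒴 𝒵 : Type u}
    [MeasurableSpace 𝒳] [MeasurableSpace 𝒴] [MeasurableSpace 𝒵]
    (loss : 𝒵 → 𝒴 → ℝ) (hloss : Measurable (Function.uncurry loss))
    (lam : ℝ) (hlam : 0 < lam) (P : ProbabilityMeasure (𝒳 × 𝒴)) :
    (⨅ (κ : Kernel 𝒳 𝒵) (_ : IsMarkovKernel κ),
        lagrangian lam (channelRisk κ loss (P : Measure (𝒳 × 𝒴)))
          (channelInfo κ (P : Measure (𝒳 × 𝒴)) : EReal))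
      ≤ minimaxCost loss lam {P} := by
  refine le_iInf fun S => ?_
  rw [iSup_singleton]
  refine (iInf₂_le S.channel (inferInstance : IsMarkovKernel S.channel)).trans ?_
  rw [Scheme.cost, S.risk_eq_channelRisk hloss]
  exact lagrangian_mono hlam _ (by exact_mod_cast S.channelInfo_channel_le_rate _)

/-! ### A prefix code for the natural numbers -/

/-- The binary digits of `a` at the positions below `k`, as a string of length `k`. -/
def fixedBits (k a : ℕ) : List Bool := List.ofFn fun t : Fin k => a.testBit t

@[simp]
theorem length_fixedBits (k a : ℕ) : (fixedBits k a).length = k := by simp [fixedBits]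

theorem fixedBits_injOn {k a b : ℕ} (ha : a < 2 ^ k) (hb : b < 2 ^ k)
    (h : fixedBits k a = fixedBits k b) : a = b := by
  refine Nat.eq_of_testBit_eq fun t => ?_
  by_cases ht : t < k
  · exact congrFun (List.ofFn_injective h) ⟨t, ht⟩
  · rw [Nat.testBit_lt_two_pow (ha.trans_le (Nat.pow_le_pow_right two_pos (not_lt.mp ht))),
      Nat.testBit_lt_two_pow (hb.trans_le (Nat.pow_le_pow_right two_pos (not_lt.mp ht)))]

theorem eq_and_prefix_of_append_prefix {α : Type*} {l l' a b : List α}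
    (hl : l.length = l'.length) (h : l ++ a <+: l' ++ b) : l = l' ∧ a <+: b := by
  obtain ⟨c, hc⟩ := h
  rw [List.append_assoc] at hc
  obtain ⟨h1, h2⟩ := List.append_inj hc hl
  exact ⟨h1, c, h2⟩

theorem eq_and_prefix_of_replicate_true_prefix {q q' : ℕ} {a b : List Bool}
    (h : List.replicate q true ++ false :: a <+: List.replicate q' true ++ false :: b) :
    q = q' ∧ a <+: b := by
  induction q generalizing q' with
  | zero =>
    cases q' with
    | zero => simpa using h
    | succ q' => simp [List.replicate_succ] at h
  | succ q ih =>
    cases q' with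
    | zero => simp [List.replicate_succ] at h
    | succ q' =>
      simp only [List.replicate_succ, List.cons_append, List.cons_prefix_cons, true_and] at h
      have := ih h
      exact ⟨by omega, this.2⟩

/-- A prefix code for the natural numbers. The bit length `n` of `i + 1` is written in the Rice code
with parameter `j`, that is `n / 2 ^ j` in unary followed by the `j` digits of `n % 2 ^ j`; then
come the `n` binary digits of `i + 1` after the leading one. -/
def riceCode (j i : ℕ) : List Bool :=
  List.replicate (Nat.log 2 (i + 1) / 2 ^ j) true ++ false ::
    (fixedBits j (Nat.log 2 (i + 1) % 2 ^ j) ++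
      fixedBits (Nat.log 2 (i + 1)) (i + 1 - 2 ^ Nat.log 2 (i + 1)))

theorem length_riceCode (j i : ℕ) :
    (riceCode j i).length = Nat.log 2 (i + 1) / 2 ^ j + (1 + j + Nat.log 2 (i + 1)) := by
  simp [riceCode]
  omega

theorem eq_of_riceCode_prefix {j i i' : ℕ} (h : riceCode j i <+: riceCode j i') : i = i' := by
  obtain ⟨hq, h⟩ := eq_and_prefix_of_replicate_true_prefix h
  obtain ⟨hr, h⟩ := eq_and_prefix_of_append_prefix (by simp) h
  have hr' := fixedBits_injOn (Nat.mod_lt _ (by positivity)) (Nat.mod_lt _ (by positivity)) hr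
  have hn : Nat.log 2 (i + 1) = Nat.log 2 (i' + 1) := by
    rw [← Nat.div_add_mod (Nat.log 2 (i + 1)) (2 ^ j), hq, hr', Nat.div_add_mod]
  have hbound : ∀ k : ℕ, 2 ^ Nat.log 2 (k + 1) ≤ k + 1 ∧ k + 1 < 2 * 2 ^ Nat.log 2 (k + 1) :=
    fun k => ⟨Nat.pow_log_le_self 2 (by omega), by
      rw [← pow_succ']; exact Nat.lt_pow_succ_log_self (by omega) _⟩
  have h1 := hbound i
  have h2 := hbound i'
  rw [← hn] at h h2
  have := fixedBits_injOn (by omega) (by omega) (h.eq_of_length (by simp))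
  omega

theorem riceCode_injective (j : ℕ) : Function.Injective (riceCode j) := fun i i' h =>
  eq_of_riceCode_prefix (by rw [h])

theorem prefixFree_range_riceCode (j : ℕ) : PrefixFree (Set.range (riceCode j)) := by
  rintro _ ⟨i, rfl⟩ _ ⟨i', rfl⟩ h
  rw [eq_of_riceCode_prefix h]

theorem length_riceCode_le (j i : ℕ) :
    ((riceCode j i).length : ℝ)
      ≤ (1 + (2 ^ j)⁻¹) / Real.log 2 * Real.log (i + 1) + (1 + j) := by
  have hlog : 0 < Real.log 2 := Real.log_pos one_lt_two
  have hn : (Nat.log 2 (i + 1) : ℝ) ≤ Real.log (i + 1) / Real.log 2 := by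
    rw [le_div_iff₀ hlog, ← Real.log_pow]
    refine Real.log_le_log (by positivity) ?_
    exact_mod_cast Nat.pow_log_le_self 2 (by omega)
  have hd : ((Nat.log 2 (i + 1) / 2 ^ j : ℕ) : ℝ) ≤ Nat.log 2 (i + 1) * (2 ^ j)⁻¹ := by
    rw [← div_eq_mul_inv]
    exact_mod_cast (Nat.cast_div_le (α := ℝ) (m := Nat.log 2 (i + 1)) (n := 2 ^ j))
  rw [length_riceCode]
  push_cast
  have : (1 + (2 ^ j)⁻¹) / Real.log 2 * Real.log (i + 1)
      = (Real.log (i + 1) / Real.log 2) * (1 + ((2:ℝ) ^ j)⁻¹) := by ring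
  rw [this]
  have hm := mul_le_mul_of_nonneg_right hn (by positivity : (0:ℝ) ≤ 1 + (2 ^ j)⁻¹)
  linarith

/-- The choice of the parameter of the code: `2 ^ j ≤ I + 1 < 2 ^ (j + 1)`. -/
theorem exists_riceCode_parameter {I : ℝ} (hI : 0 ≤ I) :
    ∃ j : ℕ, (1 + (2 ^ j)⁻¹) / Real.log 2 * (I * Real.log 2 + 1) + (1 + j)
      ≤ I + Real.log (I + 1) / Real.log 2 + 5 := by
  obtain ⟨j, h1, h2⟩ := exists_nat_pow_near (x := I + 1) (y := 2) (by linarith) one_lt_two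
  refine ⟨j, ?_⟩
  have hl : 2 / 3 ≤ Real.log 2 := by linarith [Real.log_two_gt_d9]
  have hlog : 0 < Real.log 2 := by linarith
  have hp : (1:ℝ) ≤ 2 ^ j := one_le_pow₀ (by norm_num)
  have hj : (j : ℝ) ≤ Real.log (I + 1) / Real.log 2 := by
    rw [le_div_iff₀ hlog, ← Real.log_pow]
    exact Real.log_le_log (by positivity) h1
  have hinv : (Real.log 2)⁻¹ ≤ 3 / 2 := by
    rw [inv_le_comm₀ hlog (by norm_num)]; linarith
  have heq : (1 + ((2:ℝ) ^ j)⁻¹) / Real.log 2 * (I * Real.log 2 + 1)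
      = (1 + (2 ^ j)⁻¹) * (I + (Real.log 2)⁻¹) := by field_simp
  -- the total is at most `(I + 1) + 1 / 2 + 2 + 1 / 2 + (1 + j)`
  have hI2 : (2 ^ j)⁻¹ * (I + 1) ≤ 2 := by
    rw [inv_mul_le_iff₀ (by positivity)]
    rw [pow_succ] at h2
    exact h2.le
  have hinvp : ((2:ℝ) ^ j)⁻¹ ≤ 1 := inv_le_one_of_one_le₀ hp
  have hpos : (0:ℝ) ≤ 1 + (2 ^ j)⁻¹ := by positivity
  rw [heq]
  have := mul_le_mul_of_nonneg_left hinv hpos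
  nlinarith

/-! ### Distribution functions and uniform variables -/

/-- The probability integral transform: evaluated at the variable itself, a distribution function
dominates a uniform variable. -/
theorem measure_measure_le_le {Ω α : Type*} [MeasurableSpace Ω] (m : Measure Ω)
    [CompleteLinearOrder α] [TopologicalSpace α] [OrderTopology α] [DenselyOrdered α]
    [FirstCountableTopology α] (U : Ω → α) (t : ℝ≥0∞) :
    m {ω | m {ω' | U ω' ≤ U ω} ≤ t} ≤ t := by
  set J : Set α := {u | m {ω' | U ω' ≤ u} ≤ t} with hJ
  have hlower : ∀ u ∈ J, ∀ u' ≤ u, u' ∈ J := fun u hu u' huu' =>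
    (measure_mono fun ω (hω : U ω ≤ u') => hω.trans huu').trans hu
  by_cases hmem : sSup J ∈ J
  · exact (measure_mono fun ω (hω : U ω ∈ J) => le_sSup hω).trans hmem
  · rcases eq_bot_or_bot_lt (sSup J) with hbot | hbot
    · have : {ω | m {ω' | U ω' ≤ U ω} ≤ t} = ∅ := by
        ext ω
        simp only [Set.mem_ofPred_eq, Set.mem_empty_iff_false, iff_false]
        intro hω
        have hω' : U ω ∈ J := hω
        have : U ω = sSup J := le_antisymm (le_sSup hω') (hbot ▸ bot_le)
        exact hmem (this ▸ hω')
      simp [this]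
    · obtain ⟨u, humono, hu, hulim⟩ := exists_seq_strictMono_tendsto' hbot
      have hsub : {ω | m {ω' | U ω' ≤ U ω} ≤ t} ⊆ ⋃ n, {ω | U ω ≤ u n} := by
        intro ω hω
        have hω' : U ω ∈ J := hω
        have hlt : U ω < sSup J :=
          lt_of_le_of_ne (le_sSup hω') fun h => hmem (h ▸ hω')
        obtain ⟨n, hn⟩ := (hulim.eventually (lt_mem_nhds hlt)).exists
        exact Set.mem_iUnion.mpr ⟨n, hn.le⟩
      refine (measure_mono hsub).trans ?_
      have hmono : Monotone fun n => {ω | U ω ≤ u n} := fun a b hab ω (hω : U ω ≤ u a) =>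
        hω.trans (humono.monotone hab)
      rw [hmono.directed_le.measure_iUnion]
      refine iSup_le fun n => ?_
      obtain ⟨v, hv, huv⟩ := lt_sSup_iff.mp (hu n).2
      exact hlower v hv _ huv.le

/-- If `X` dominates a uniform variable on `[0, 1]` then `-log X` has expectation at most `1`. -/
theorem lintegral_neg_log_le_one {Ω : Type*} [MeasurableSpace Ω] (m : Measure Ω) {X : Ω → ℝ≥0∞}
    (hX : Measurable X) (hX1 : ∀ ω, X ω ≤ 1) (h : ∀ t, m {ω | X ω ≤ t} ≤ t) :
    ∫⁻ ω, ENNReal.ofReal (-Real.log (X ω).toReal) ∂m ≤ 1 := by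
  have hXr : ∀ ω, (X ω).toReal ≤ 1 := fun ω => by
    rw [← ENNReal.toReal_one]; exact ENNReal.toReal_mono ENNReal.one_ne_top (hX1 ω)
  rw [lintegral_eq_lintegral_meas_lt m
    (Filter.Eventually.of_forall fun ω =>
      neg_nonneg.mpr (Real.log_nonpos ENNReal.toReal_nonneg (hXr ω)))
    (Real.measurable_log.comp hX.ennreal_toReal).neg.aemeasurable]
  calc ∫⁻ t in Set.Ioi (0:ℝ), m {ω | t < -Real.log (X ω).toReal}
      ≤ ∫⁻ t in Set.Ioi (0:ℝ), ENNReal.ofReal (Real.exp (-t)) := by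
        refine setLIntegral_mono (by fun_prop) fun t ht => ?_
        refine (measure_mono fun ω hω => ?_).trans (h _)
        have hω : t < -Real.log (X ω).toReal := hω
        change X ω ≤ _
        rw [← ENNReal.ofReal_toReal (ne_top_of_le_ne_top ENNReal.one_ne_top (hX1 ω))]
        refine ENNReal.ofReal_le_ofReal ?_
        rcases eq_or_lt_of_le (ENNReal.toReal_nonneg (a := X ω)) with h0 | h0
        · rw [← h0]; positivity
        · rw [← Real.log_le_iff_le_exp h0]; linarith
    _ = 1 := by
        rw [← ofReal_integral_eq_lintegral_ofReal (integrableOn_exp_neg_Ioi 0)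
          (Filter.Eventually.of_forall fun t => (Real.exp_pos _).le), integral_exp_neg_Ioi_zero,
          ENNReal.ofReal_one]

theorem volume_ofReal_lt (a : ℝ≥0∞) :
    volume {v : unitInterval | ENNReal.ofReal v < a} = min a 1 := by
  rcases lt_or_ge 1 a with h | h
  · have : {v : unitInterval | ENNReal.ofReal v < a} = Set.univ := by
      ext v
      simp only [Set.mem_ofPred_eq, Set.mem_univ, iff_true]
      refine lt_of_le_of_lt ?_ h
      rw [← ENNReal.ofReal_one]
      exact ENNReal.ofReal_le_ofReal v.2.2
    rw [this, measure_univ, min_eq_right h.le]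
  · have ha : a ≠ ∞ := ne_top_of_le_ne_top ENNReal.one_ne_top h
    have ha1 : a.toReal ≤ 1 := by
      rw [← ENNReal.toReal_one]; exact ENNReal.toReal_mono ENNReal.one_ne_top h
    have : {v : unitInterval | ENNReal.ofReal v < a}
        = Set.Iio ⟨a.toReal, ENNReal.toReal_nonneg, ha1⟩ := by
      ext v
      simp only [Set.mem_ofPred_eq, Set.mem_Iio, ← Subtype.coe_lt_coe]
      exact ENNReal.ofReal_lt_iff_lt_toReal v.2.1 ha
    rw [this, unitInterval.volume_Iio, min_eq_left h]
    exact ENNReal.ofReal_toReal ha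

theorem volume_ofReal_le (a : ℝ≥0∞) :
    volume {v : unitInterval | ENNReal.ofReal v ≤ a} = min a 1 := by
  refine le_antisymm ?_ ?_
  · refine le_min ?_ prob_le_one
    rcases eq_or_ne a ∞ with rfl | ha
    · exact le_top
    rcases le_or_gt a 1 with h | h
    · have ha1 : a.toReal ≤ 1 := by
        rw [← ENNReal.toReal_one]; exact ENNReal.toReal_mono ENNReal.one_ne_top h
      refine (measure_mono (t := Set.Iic ⟨a.toReal, ENNReal.toReal_nonneg, ha1⟩)
        fun v hv => ?_).trans ?_
      · exact (ENNReal.ofReal_le_iff_le_toReal ha).mp hv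
      · rw [unitInterval.volume_Iic]
        exact (ENNReal.ofReal_toReal ha).le
    · exact prob_le_one.trans h.le
  · rw [← volume_ofReal_lt]
    exact measure_mono fun v (hv : ENNReal.ofReal v < a) => hv.le

/-- A uniform point of the layer between `L` and `L + s` lies below the height `ρ` with
probability `(min ρ (L + s) - min ρ L) / s`. -/
theorem mul_volume_layer_add {L s ρ : ℝ≥0∞} (hs : s ≠ ∞) :
    s * volume {v : unitInterval | L + s * ENNReal.ofReal v < ρ} + min ρ L = min ρ (L + s) := by
  rcases eq_or_ne s 0 with rfl | hs0
  · simp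
  rcases le_or_gt ρ L with h | h
  · have : {v : unitInterval | L + s * ENNReal.ofReal v < ρ} = ∅ := by
      ext v
      simp only [Set.mem_ofPred_eq, Set.mem_empty_iff_false, iff_false, not_lt]
      exact h.trans le_self_add
    rw [this, measure_empty, mul_zero, zero_add, min_eq_left h,
      min_eq_left (h.trans le_self_add)]
  · have : {v : unitInterval | L + s * ENNReal.ofReal v < ρ}
        = {v : unitInterval | ENNReal.ofReal v < (ρ - L) / s} := by
      ext v
      simp only [Set.mem_ofPred_eq]
      rw [ENNReal.lt_div_iff_mul_lt (Or.inl hs0) (Or.inl hs), lt_tsub_iff_left, mul_comm s]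
    rw [this, volume_ofReal_lt, min_eq_right h.le, mul_min, mul_one,
      ENNReal.mul_div_cancel hs0 hs, min_add, tsub_add_cancel_of_le h.le, add_comm s]

theorem mul_volume_mul_le {ρ : ℝ≥0∞} (hρ : ρ ≠ ∞) (u : ℝ≥0∞) :
    ρ * volume {v : unitInterval | ρ * ENNReal.ofReal v ≤ u} = min ρ u := by
  rcases eq_or_ne ρ 0 with rfl | h0
  · simp
  have : {v : unitInterval | ρ * ENNReal.ofReal v ≤ u}
      = {v : unitInterval | ENNReal.ofReal v ≤ u / ρ} := by
    ext v
    simp only [Set.mem_ofPred_eq]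
    rw [ENNReal.le_div_iff_mul_le (Or.inl h0) (Or.inl hρ), mul_comm]
  rw [this, volume_ofReal_le, mul_min, mul_one, ENNReal.mul_div_cancel h0 hρ, min_comm]

theorem mul_volume_mul_lt {ρ : ℝ≥0∞} (hρ : ρ ≠ ∞) (u : ℝ≥0∞) :
    ρ * volume {v : unitInterval | ρ * ENNReal.ofReal v < u} = min ρ u := by
  rcases eq_or_ne ρ 0 with rfl | h0
  · simp
  have : {v : unitInterval | ρ * ENNReal.ofReal v < u}
      = {v : unitInterval | ENNReal.ofReal v < u / ρ} := by
    ext v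
    simp only [Set.mem_ofPred_eq]
    rw [ENNReal.lt_div_iff_mul_lt (Or.inl h0) (Or.inl hρ), mul_comm]
  rw [this, volume_ofReal_lt, mul_min, mul_one, ENNReal.mul_div_cancel h0 hρ, min_comm]

theorem one_le_lintegral_neg_log :
    1 ≤ ∫⁻ v : unitInterval, ENNReal.ofReal (-Real.log v) := by
  have hm : Measurable fun x : ℝ => ENNReal.ofReal (-Real.log x) :=
    Real.measurable_log.neg.ennreal_ofReal
  have h1 : ∫⁻ v : unitInterval, ENNReal.ofReal (-Real.log v)
      = ∫⁻ x in unitInterval, ENNReal.ofReal (-Real.log x) :=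
    unitInterval.measurePreserving_coe.lintegral_comp hm
  have hint : IntervalIntegrable (fun x => -Real.log x) volume 0 1 :=
    intervalIntegral.intervalIntegrable_log'.neg
  rw [h1, unitInterval, ← restrict_Ioc_eq_restrict_Icc, ← ofReal_integral_eq_lintegral_ofReal,
    ← intervalIntegral.integral_of_le zero_le_one, intervalIntegral.integral_neg, integral_log]
  · simp
  · exact (intervalIntegrable_iff_integrableOn_Ioc_of_le zero_le_one).mp hint
  · exact (ae_restrict_iff' measurableSet_Ioc).mpr (Filter.Eventually.of_forall fun x hx =>
      neg_nonneg.mpr (Real.log_nonpos hx.1.le hx.2))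

section GreedySampling

/-! ### The layers of greedy rejection sampling -/

variable {α : Type*} [MeasurableSpace α]

/-- The mass that lies under both the density `r` and the height `t`. -/
noncomputable def cappedMass (Q : Measure α) (r : α → ℝ≥0∞) (t : ℝ≥0∞) : ℝ≥0∞ :=
  ∫⁻ z, min (r z) t ∂Q

/-- The height up to which greedy rejection sampling has exhausted the density `r` after `i`
proposals. The `i`-th layer is as thick as the mass that is still missing. -/
noncomputable def level (Q : Measure α) (r : α → ℝ≥0∞) : ℕ → ℝ≥0∞
  | 0 => 0
  | i + 1 => level Q r i + (1 - cappedMass Q r (level Q r i))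

theorem cappedMass_mono (Q : Measure α) (r : α → ℝ≥0∞) : Monotone (cappedMass Q r) :=
  fun _ _ h => lintegral_mono fun _ => min_le_min_left _ h

theorem cappedMass_le (Q : Measure α) [IsProbabilityMeasure Q] (r : α → ℝ≥0∞) (t : ℝ≥0∞) :
    cappedMass Q r t ≤ t :=
  (lintegral_mono fun _ => min_le_right _ _).trans (by simp)

theorem cappedMass_zero (Q : Measure α) (r : α → ℝ≥0∞) : cappedMass Q r 0 = 0 := by
  simp [cappedMass]

theorem cappedMass_le_lintegral (Q : Measure α) (r : α → ℝ≥0∞) (t : ℝ≥0∞) :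
    cappedMass Q r t ≤ ∫⁻ z, r z ∂Q := lintegral_mono fun _ => min_le_left _ _

theorem level_mono (Q : Measure α) (r : α → ℝ≥0∞) : Monotone (level Q r) :=
  monotone_nat_of_le_succ fun _ => le_self_add

theorem level_eq_sum (Q : Measure α) (r : α → ℝ≥0∞) (i : ℕ) :
    level Q r i = ∑ j ∈ Finset.range i, (1 - cappedMass Q r (level Q r j)) := by
  induction i with
  | zero => simp [level]
  | succ i ih => rw [Finset.sum_range_succ, ← ih, level]

/-- The layers below `u` are each at least as thick as the mass above `u`. -/
theorem mul_one_sub_le_level (Q : Measure α) (r : α → ℝ≥0∞) {i : ℕ} {u : ℝ≥0∞}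
    (h : level Q r i ≤ u) : i * (1 - cappedMass Q r u) ≤ level Q r i := by
  rw [level_eq_sum, ← nsmul_eq_mul, ← Finset.card_range i, ← Finset.sum_const, Finset.card_range]
  refine Finset.sum_le_sum fun j hj => tsub_le_tsub_left (cappedMass_mono Q r ?_) _
  exact (level_mono Q r (Finset.mem_range.mp hj).le).trans h

/-- Greedy rejection sampling exhausts the whole mass of a probability density. -/
theorem iSup_cappedMass_level {Q : Measure α} [IsProbabilityMeasure Q] {r : α → ℝ≥0∞}
    (hr : Measurable r) (hr1 : ∫⁻ z, r z ∂Q = 1) : ⨆ i, cappedMass Q r (level Q r i) = 1 := by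
  have hle : ∀ t, cappedMass Q r t ≤ 1 := fun t => hr1 ▸ cappedMass_le_lintegral Q r t
  refine le_antisymm (iSup_le fun i => hle _) ?_
  have hsup : ⨆ i, cappedMass Q r (level Q r i) = ∫⁻ z, min (r z) (⨆ i, level Q r i) ∂Q := by
    simp only [cappedMass]
    rw [← lintegral_iSup (fun i => hr.min measurable_const)
      (fun i j hij z => min_le_min_left _ (level_mono Q r hij))]
    refine lintegral_congr fun z => ?_
    exact (inf_iSup_eq _ _).symm
  by_cases htop : ⨆ i, level Q r i = ∞
  · rw [hsup, htop]
    simp [hr1]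
  · -- the thicknesses are summable, so the missing mass tends to zero
    have hsum : ∑' i, (1 - cappedMass Q r (level Q r i)) ≠ ∞ := by
      rw [ENNReal.tsum_eq_iSup_nat]
      simpa only [← level_eq_sum] using htop
    have hlim := ENNReal.tendsto_atTop_zero_of_tsum_ne_top hsum
    have hbound : ∀ i, 1 - (⨆ i, cappedMass Q r (level Q r i))
        ≤ 1 - cappedMass Q r (level Q r i) := fun i =>
      tsub_le_tsub_left (le_iSup (fun i => cappedMass Q r (level Q r i)) i) _
    have := ge_of_tendsto' hlim hbound
    exact tsub_eq_zero_iff_le.mp (nonpos_iff_eq_zero.mp this)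

/-! ### The expected logarithm of the accepted index -/

section Height

/-- The law of a point chosen uniformly under the graph of the density `r`: its abscissa has
density `r`, and its height is a uniform fraction of the value of `r` there. -/
noncomputable def graphLaw (Q : Measure α) (r : α → ℝ≥0∞) : Measure (α × unitInterval) :=
  (Q.withDensity r).prod volume

/-- The height of a point under the graph of `r`. -/
noncomputable def height (r : α → ℝ≥0∞) (ω : α × unitInterval) : ℝ≥0∞ :=
  r ω.1 * ENNReal.ofReal ω.2

theorem measurable_height {r : α → ℝ≥0∞} (hr : Measurable r) : Measurable (height r) :=
  (hr.comp measurable_fst).mul (measurable_subtype_coe.comp measurable_snd).ennreal_ofReal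

variable {Q : Measure α} {r : α → ℝ≥0∞}

theorem isProbabilityMeasure_withDensity_of_lintegral (hr1 : ∫⁻ z, r z ∂Q = 1) :
    IsProbabilityMeasure (Q.withDensity r) :=
  ⟨by rw [withDensity_apply _ MeasurableSet.univ, Measure.restrict_univ, hr1]⟩

theorem ae_ne_top_of_lintegral (hr : Measurable r) (hr1 : ∫⁻ z, r z ∂Q = 1) :
    ∀ᵐ z ∂Q, r z ≠ ∞ := by
  filter_upwards [ae_lt_top hr (by rw [hr1]; exact ENNReal.one_ne_top)] with z hz
  exact hz.ne

theorem graphLaw_height_le (hr : Measurable r) (hr1 : ∫⁻ z, r z ∂Q = 1) (u : ℝ≥0∞) :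
    graphLaw Q r {ω | height r ω ≤ u} = cappedMass Q r u := by
  have hms : MeasurableSet {ω | height r ω ≤ u} := measurable_height hr measurableSet_Iic
  rw [graphLaw, Measure.prod_apply hms,
    lintegral_withDensity_eq_lintegral_mul _ hr (measurable_measure_prodMk_left hms)]
  refine lintegral_congr_ae ?_
  filter_upwards [ae_ne_top_of_lintegral hr hr1] with z hz
  exact mul_volume_mul_le hz u

theorem graphLaw_height_lt (hr : Measurable r) (hr1 : ∫⁻ z, r z ∂Q = 1) (u : ℝ≥0∞) :
    graphLaw Q r {ω | height r ω < u} = cappedMass Q r u := by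
  have hms : MeasurableSet {ω | height r ω < u} := measurable_height hr measurableSet_Iio
  rw [graphLaw, Measure.prod_apply hms,
    lintegral_withDensity_eq_lintegral_mul _ hr (measurable_measure_prodMk_left hms)]
  refine lintegral_congr_ae ?_
  filter_upwards [ae_ne_top_of_lintegral hr hr1] with z hz
  exact mul_volume_mul_lt hz u

theorem lintegral_fst_graphLaw (hr : Measurable r) {g : α → ℝ≥0∞} (hg : Measurable g) :
    ∫⁻ ω, g ω.1 ∂(graphLaw Q r) = ∫⁻ z, r z * g z ∂Q := by
  have hg' : Measurable fun ω : α × unitInterval => g ω.1 := hg.comp measurable_fst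
  rw [graphLaw, lintegral_prod _ hg'.aemeasurable]
  simp only [lintegral_const, measure_univ, mul_one]
  exact lintegral_withDensity_eq_lintegral_mul _ hr hg

variable [IsProbabilityMeasure Q]

/-- The divergence of the density `r`, split into the two parts of the integral of `log r`. -/
theorem lintegral_log_add_one (hr : Measurable r) (hr1 : ∫⁻ z, r z ∂Q = 1) :
    ∫⁻ z, r z * ENNReal.ofReal (Real.log (r z).toReal) ∂Q + 1
      = ∫⁻ z, ENNReal.ofReal (InformationTheory.klFun (r z).toReal) ∂Q
        + ∫⁻ z, r z * ENNReal.ofReal (-Real.log (r z).toReal) ∂Q + 1 := by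
  have hlog : Measurable fun z => Real.log (r z).toReal :=
    Real.measurable_log.comp hr.ennreal_toReal
  have hneg : Measurable fun z => r z * ENNReal.ofReal (-Real.log (r z).toReal) :=
    hr.mul hlog.neg.ennreal_ofReal
  calc _ = ∫⁻ z, (r z * ENNReal.ofReal (Real.log (r z).toReal) + 1) ∂Q := by
        rw [lintegral_add_right _ measurable_const]
        simp
    _ = ∫⁻ z, (ENNReal.ofReal (InformationTheory.klFun (r z).toReal)
          + r z * ENNReal.ofReal (-Real.log (r z).toReal) + r z) ∂Q := by
        refine lintegral_congr_ae ?_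
        filter_upwards [ae_ne_top_of_lintegral hr hr1] with z hz
        lift r z to NNReal using hz with ρ
        have hρ : (ρ : ℝ≥0∞) = ENNReal.ofReal ρ := (ENNReal.ofReal_coe_nnreal).symm
        have hk : 0 ≤ InformationTheory.klFun ρ := InformationTheory.klFun_nonneg ρ.coe_nonneg
        rw [ENNReal.coe_toReal, hρ, ← ENNReal.ofReal_mul ρ.coe_nonneg,
          ← ENNReal.ofReal_mul ρ.coe_nonneg, ← ENNReal.ofReal_one]
        rcases le_total (ρ : ℝ) 1 with h | h
        · have hl := mul_nonneg ρ.coe_nonneg (neg_nonneg.mpr (Real.log_nonpos ρ.coe_nonneg h))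
          have hl' : (ρ : ℝ) * Real.log ρ ≤ 0 := by linarith
          rw [ENNReal.ofReal_of_nonpos hl', zero_add, ← ENNReal.ofReal_add hk hl,
            ← ENNReal.ofReal_add (by positivity) ρ.coe_nonneg, InformationTheory.klFun_apply]
          congr 1
          ring
        · have hl := mul_nonneg ρ.coe_nonneg (Real.log_nonneg h)
          have hl' : (ρ : ℝ) * -Real.log ρ ≤ 0 := by linarith
          rw [ENNReal.ofReal_of_nonpos hl', add_zero, ← ENNReal.ofReal_add hl zero_le_one,
            ← ENNReal.ofReal_add hk ρ.coe_nonneg, InformationTheory.klFun_apply]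
          congr 1
          ring
    _ = _ := by rw [lintegral_add_right _ hr, lintegral_add_right _ hneg, hr1]

theorem lintegral_mul_neg_log_le_one (hr : Measurable r) (hr1 : ∫⁻ z, r z ∂Q = 1) :
    ∫⁻ z, r z * ENNReal.ofReal (-Real.log (r z).toReal) ∂Q ≤ 1 := by
  calc _ ≤ ∫⁻ _, 1 ∂Q := by
        refine lintegral_mono_ae ?_
        filter_upwards [ae_ne_top_of_lintegral hr hr1] with z hz
        lift r z to NNReal using hz with ρ
        rw [ENNReal.coe_toReal, ← ENNReal.ofReal_coe_nnreal, ← ENNReal.ofReal_mul ρ.coe_nonneg,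
          ← ENNReal.ofReal_one]
        refine ENNReal.ofReal_le_ofReal ?_
        have h := InformationTheory.klFun_nonneg ρ.coe_nonneg
        rw [InformationTheory.klFun_apply] at h
        have hρ : (0:ℝ) ≤ ρ := ρ.coe_nonneg
        linarith
    _ = 1 := by simp

/-- The pointwise form of the bound on the index of the accepted proposal: with `X = F(u)`, a point
at height `u = ρ v` above the `i`-th level satisfies `(i + 1) X (1 - X) ≤ u`. The signed quantity
`log ρ` is split into its two parts so that both sides can be integrated in `[0, ∞]`. -/
theorem log_index_add_le {i : ℕ} {ρ : ℝ≥0∞} (hρ0 : ρ ≠ 0) (hρ : ρ ≠ ∞) {v : ℝ} (hv0 : 0 < v)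
    (hv1 : v ≤ 1) {X : ℝ≥0∞} (hX0 : X ≠ 0) (hX1 : 1 - X ≠ 0) (hXu : X ≤ ρ * ENNReal.ofReal v)
    (hi : i * (1 - X) ≤ ρ * ENNReal.ofReal v) :
    ENNReal.ofReal (Real.log (i + 1)) + ENNReal.ofReal (-Real.log v)
        + ENNReal.ofReal (-Real.log ρ.toReal)
      ≤ ENNReal.ofReal (Real.log ρ.toReal) + ENNReal.ofReal (-Real.log X.toReal)
        + ENNReal.ofReal (-Real.log (1 - X).toReal) := by
  have hXlt : X < 1 := by
    by_contra h
    exact hX1 (tsub_eq_zero_of_le (not_lt.mp h))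
  lift X to NNReal using hXlt.ne_top with x
  lift ρ to NNReal using hρ with a
  have hx1 : x < 1 := by exact_mod_cast hXlt
  have h1x : (1 - (x : ℝ≥0∞)) = ENNReal.ofReal (1 - x) := by
    rw [ENNReal.ofReal_sub _ x.coe_nonneg]; simp
  have ha : (0:ℝ) < a := by
    have : a ≠ 0 := by exact_mod_cast hρ0
    positivity
  have hx : (0:ℝ) < x := by
    have : x ≠ 0 := by exact_mod_cast hX0
    positivity
  have hx1' : (0:ℝ) < 1 - x := by
    have : (x:ℝ) < 1 := by exact_mod_cast hx1
    linarith
  rw [← ENNReal.ofReal_coe_nnreal (p := a), ← ENNReal.ofReal_mul ha.le] at hXu hi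
  rw [← ENNReal.ofReal_coe_nnreal (p := x), ENNReal.ofReal_le_ofReal_iff (by positivity)] at hXu
  rw [h1x, ← ENNReal.ofReal_natCast, ← ENNReal.ofReal_mul (by positivity),
    ENNReal.ofReal_le_ofReal_iff (by positivity)] at hi
  have key : ((i:ℝ) + 1) * x * (1 - x) ≤ a * v := by nlinarith
  have hlog := Real.log_le_log (by positivity) key
  rw [Real.log_mul (by positivity) hx1'.ne', Real.log_mul (by positivity) hx.ne',
    Real.log_mul ha.ne' hv0.ne'] at hlog
  have hi0 : 0 ≤ Real.log ((i:ℝ) + 1) := Real.log_nonneg (by linarith [Nat.cast_nonneg (α := ℝ) i])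
  have hv : 0 ≤ -Real.log v := neg_nonneg.mpr (Real.log_nonpos hv0.le hv1)
  have hxl : 0 ≤ -Real.log x := neg_nonneg.mpr (Real.log_nonpos hx.le (by linarith))
  have hyl : 0 ≤ -Real.log (1 - x) := neg_nonneg.mpr (Real.log_nonpos hx1'.le (by linarith))
  rw [h1x, ENNReal.toReal_ofReal hx1'.le, ENNReal.coe_toReal, ENNReal.coe_toReal,
    ← ENNReal.ofReal_add hi0 hv]
  rcases le_total 0 (Real.log a) with h | h
  · rw [ENNReal.ofReal_of_nonpos (neg_nonpos.mpr h), add_zero, ← ENNReal.ofReal_add h hxl,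
      ← ENNReal.ofReal_add (by positivity) hyl]
    exact ENNReal.ofReal_le_ofReal (by linarith)
  · rw [ENNReal.ofReal_of_nonpos h, zero_add, ← ENNReal.ofReal_add hxl hyl,
      ← ENNReal.ofReal_add (by positivity) (neg_nonneg.mpr h)]
    exact ENNReal.ofReal_le_ofReal (by linarith)

/-- The expected logarithm of the (one-based) index of the accepted proposal exceeds the
divergence of the target from the proposal law by at most one nat. -/
theorem tsum_log_mul_layer_le (hr : Measurable r) (hr1 : ∫⁻ z, r z ∂Q = 1) :
    ∑' i : ℕ, ENNReal.ofReal (Real.log (i + 1))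
        * (cappedMass Q r (level Q r (i + 1)) - cappedMass Q r (level Q r i))
      ≤ ∫⁻ z, ENNReal.ofReal (InformationTheory.klFun (r z).toReal) ∂Q + 1 := by
  have := isProbabilityMeasure_withDensity_of_lintegral hr1
  set m := graphLaw Q r with hm
  have hmprob : IsProbabilityMeasure m := by rw [hm, graphLaw]; infer_instance
  have hU := measurable_height hr
  have hF1 : ∀ t, cappedMass Q r t ≤ 1 := fun t => hr1 ▸ cappedMass_le_lintegral Q r t
  set E : ℕ → Set (α × unitInterval) :=
    fun i => {ω | height r ω ≤ level Q r (i + 1)} \ {ω | height r ω ≤ level Q r i} with hE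
  have hEm : ∀ i, MeasurableSet (E i) := fun i => (hU measurableSet_Iic).diff (hU measurableSet_Iic)
  have hmE : ∀ i, m (E i)
      = cappedMass Q r (level Q r (i + 1)) - cappedMass Q r (level Q r i) := by
    intro i
    have hsub : {ω | height r ω ≤ level Q r i} ⊆ {ω | height r ω ≤ level Q r (i + 1)} :=
      fun ω (hω : height r ω ≤ level Q r i) => hω.trans (level_mono Q r (Nat.le_succ i))
    have hmi : MeasurableSet {ω | height r ω ≤ level Q r i} := hU measurableSet_Iic
    rw [hE, measure_sdiff hsub hmi.nullMeasurableSet (measure_ne_top _ _),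
      hm, graphLaw_height_le hr hr1, graphLaw_height_le hr hr1]
  set X : α × unitInterval → ℝ≥0∞ := fun ω => cappedMass Q r (height r ω) with hX
  have hXm : Measurable X := (cappedMass_mono Q r).measurable.comp hU
  have hXunif : ∀ t, m {ω | X ω ≤ t} ≤ t := by
    intro t
    have := measure_measure_le_le m (height r) t
    simpa only [hm, graphLaw_height_le hr hr1] using this
  have hYunif : ∀ t, m {ω | 1 - X ω ≤ t} ≤ t := by
    intro t
    -- the same bound for the reversed order; strict and weak inequalities for the height agree
    have := measure_measure_le_le m (fun ω => OrderDual.toDual (height r ω)) t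
    refine le_trans (measure_mono fun ω hω => ?_) this
    have hω : 1 - X ω ≤ t := hω
    refine le_trans (le_of_eq ?_) hω
    have hc : {ω' | OrderDual.toDual (height r ω') ≤ OrderDual.toDual (height r ω)}
        = {ω' | height r ω' < height r ω}ᶜ := by
      ext ω'
      simp
    have hmi : MeasurableSet {ω' | height r ω' < height r ω} := hU measurableSet_Iio
    rw [hc, prob_compl_eq_one_sub hmi, hm, graphLaw_height_lt hr hr1]
  have hXae : ∀ᵐ ω ∂m, X ω ≠ 0 := by
    rw [ae_iff]
    simpa using hXunif 0
  have hYae : ∀ᵐ ω ∂m, 1 - X ω ≠ 0 := by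
    rw [ae_iff]
    simpa using hYunif 0
  have hrae : ∀ᵐ ω ∂m, r ω.1 ≠ ∞ := by
    have h1 : ∀ᵐ z ∂(Q.withDensity r), r z ≠ ∞ :=
      (withDensity_absolutelyContinuous Q r).ae_le (ae_ne_top_of_lintegral hr hr1)
    exact Measure.quasiMeasurePreserving_fst.ae h1
  set f : α × unitInterval → ℝ≥0∞ :=
    fun ω => ∑' i : ℕ, (E i).indicator (fun _ => ENNReal.ofReal (Real.log (i + 1))) ω with hf
  have hpt : ∀ᵐ ω ∂m, f ω + ENNReal.ofReal (-Real.log ω.2)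
        + ENNReal.ofReal (-Real.log (r ω.1).toReal)
      ≤ ENNReal.ofReal (Real.log (r ω.1).toReal) + ENNReal.ofReal (-Real.log (X ω).toReal)
        + ENNReal.ofReal (-Real.log (1 - X ω).toReal) := by
    filter_upwards [hXae, hYae, hrae] with ω hX0 hY0 hrt
    have hXu : X ω ≤ height r ω := cappedMass_le Q r _
    have hu0 : height r ω ≠ 0 := fun h => hX0 (le_antisymm (h ▸ hXu) bot_le)
    have hr0 : r ω.1 ≠ 0 := left_ne_zero_of_mul hu0
    have hv0 : (0:ℝ) < ω.2 := ENNReal.ofReal_pos.mp (pos_iff_ne_zero.mpr (right_ne_zero_of_mul hu0))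
    by_cases h : ∃ i, ω ∈ E i
    · obtain ⟨i, hi⟩ := h
      have hfi : f ω = ENNReal.ofReal (Real.log (i + 1)) := by
        rw [hf]
        change ∑' i : ℕ, (E i).indicator (fun _ => ENNReal.ofReal (Real.log (i + 1))) ω = _
        rw [tsum_eq_single i, Set.indicator_of_mem hi]
        intro j hj
        refine Set.indicator_of_notMem (fun hjm => ?_) _
        rcases lt_or_gt_of_ne hj with hlt | hlt
        · exact hi.2 (le_trans (b := level Q r (j + 1)) hjm.1 (level_mono Q r hlt))
        · exact hjm.2 (le_trans (b := level Q r (i + 1)) hi.1 (level_mono Q r hlt))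
      rw [hfi]
      have hlev : level Q r i ≤ height r ω := (not_le.mp hi.2).le
      exact log_index_add_le hr0 hrt hv0 ω.2.2.2 hX0 hY0 hXu
        ((mul_one_sub_le_level Q r hlev).trans hlev)
    · -- above all levels `f` vanishes, and the bound for the index `0` suffices
      have hf0 : f ω = ENNReal.ofReal (Real.log ((0:ℕ) + 1)) := by
        push Not at h
        simp [hf, h]
      rw [hf0]
      exact log_index_add_le hr0 hrt hv0 ω.2.2.2 hX0 hY0 hXu (by simp)
  have hfint : ∫⁻ ω, f ω ∂m = ∑' i : ℕ, ENNReal.ofReal (Real.log (i + 1))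
        * (cappedMass Q r (level Q r (i + 1)) - cappedMass Q r (level Q r i)) := by
    rw [hf, lintegral_tsum fun i => (measurable_const.indicator (hEm i)).aemeasurable]
    refine tsum_congr fun i => ?_
    rw [lintegral_indicator_const (hEm i), hmE]
  have hlogr : Measurable fun z => Real.log (r z).toReal :=
    Real.measurable_log.comp hr.ennreal_toReal
  have hvm : Measurable fun ω : α × unitInterval => ENNReal.ofReal (-Real.log ω.2) :=
    (Real.measurable_log.comp (measurable_subtype_coe.comp measurable_snd)).neg.ennreal_ofReal
  have hnegm : Measurable fun ω : α × unitInterval => ENNReal.ofReal (-Real.log (r ω.1).toReal) :=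
    (hlogr.comp measurable_fst).neg.ennreal_ofReal
  have hposm : Measurable fun ω : α × unitInterval => ENNReal.ofReal (Real.log (r ω.1).toReal) :=
    (hlogr.comp measurable_fst).ennreal_ofReal
  have hXlm : Measurable fun ω => ENNReal.ofReal (-Real.log (X ω).toReal) :=
    (Real.measurable_log.comp hXm.ennreal_toReal).neg.ennreal_ofReal
  have hYm : Measurable fun ω => 1 - X ω := measurable_const.sub hXm
  have hYlm : Measurable fun ω => ENNReal.ofReal (-Real.log (1 - X ω).toReal) :=
    (Real.measurable_log.comp hYm.ennreal_toReal).neg.ennreal_ofReal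
  have hint := lintegral_mono_ae hpt
  rw [lintegral_add_right _ hnegm, lintegral_add_right _ hvm, lintegral_add_right _ hYlm,
    lintegral_add_right _ hXlm, hfint, hm,
    lintegral_fst_graphLaw hr hlogr.ennreal_ofReal,
    lintegral_fst_graphLaw hr (g := fun z => ENNReal.ofReal (-Real.log (r z).toReal))
      hlogr.neg.ennreal_ofReal, ← hm] at hint
  have hv1 : 1 ≤ ∫⁻ ω : α × unitInterval, ENNReal.ofReal (-Real.log ω.2) ∂m := by
    rw [hm, graphLaw, lintegral_prod _ hvm.aemeasurable]
    simpa using one_le_lintegral_neg_log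
  have hX1 := lintegral_neg_log_le_one m hXm (fun ω => hF1 _) hXunif
  have hY1 := lintegral_neg_log_le_one m hYm (fun ω => tsub_le_self) hYunif
  have hsplit := lintegral_log_add_one hr hr1
  set N := ∫⁻ z, r z * ENNReal.ofReal (-Real.log (r z).toReal) ∂Q with hN
  have hN1 : N ≠ ∞ := ne_top_of_le_ne_top ENNReal.one_ne_top (lintegral_mul_neg_log_le_one hr hr1)
  set D := ∫⁻ z, ENNReal.ofReal (InformationTheory.klFun (r z).toReal) ∂Q
  set S := ∑' i : ℕ, ENNReal.ofReal (Real.log (i + 1))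
        * (cappedMass Q r (level Q r (i + 1)) - cappedMass Q r (level Q r i))
  -- `N` is finite, so it may be cancelled
  have hfin : S + (1 + N) ≤ (D + 1) + (1 + N) := by
    calc S + (1 + N) = S + 1 + N := (add_assoc _ _ _).symm
      _ ≤ _ := by gcongr
      _ ≤ _ := hint
      _ ≤ ∫⁻ z, r z * ENNReal.ofReal (Real.log (r z).toReal) ∂Q + 1 + 1 := by gcongr
      _ = D + N + 1 + 1 := by rw [hsplit]
      _ = (D + 1) + (1 + N) := by ring
  exact (ENNReal.add_le_add_iff_right (by finiteness)).mp hfin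

end Height

end GreedySampling

/-! ### The law of the sampler -/

section Sampler

variable {α : Type*} [MeasurableSpace α]

/-- The proposals that greedy rejection sampling accepts in round `i`: a proposal `z` together with
a uniform variable `v` is accepted when the point at the fraction `v` of the `i`-th layer lies under
the graph of `r` at `z`. -/
def accept (Q : Measure α) (r : α → ℝ≥0∞) (i : ℕ) : Set (α × unitInterval) :=
  {p | level Q r i + (1 - cappedMass Q r (level Q r i)) * ENNReal.ofReal p.2 < r p.1}

/-- The event that the proposal of round `i` is the first one to be accepted. -/
def firstAccept (Q : Measure α) (r : α → ℝ≥0∞) (i : ℕ) : Set (ℕ → α × unitInterval) :=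
  {w | (∀ j < i, w j ∉ accept Q r j) ∧ w i ∈ accept Q r i}

/-- The index of the first accepted proposal, and `0` if no proposal is accepted. -/
noncomputable def sampleIndex (Q : Measure α) (r : α → ℝ≥0∞) (w : ℕ → α × unitInterval) : ℕ :=
  sInf {i | w i ∈ accept Q r i}

/-- The law of the sequence of independent proposals with law `Q`, each with an independent uniform
variable. -/
noncomputable def proposalLaw (Q : Measure α) : Measure (ℕ → α × unitInterval) :=
  Measure.infinitePi fun _ => Q.prod volume

theorem sampleIndex_eq {Q : Measure α} {r : α → ℝ≥0∞} {i : ℕ} {w : ℕ → α × unitInterval}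
    (hw : w ∈ firstAccept Q r i) : sampleIndex Q r w = i := by
  refine le_antisymm (Nat.sInf_le hw.2) ?_
  by_contra h
  exact hw.1 _ (not_le.mp h) (Nat.sInf_mem (s := {i | w i ∈ accept Q r i}) ⟨i, hw.2⟩)

theorem sampleIndex_eq_iff {Q : Measure α} {r : α → ℝ≥0∞} {i : ℕ} {w : ℕ → α × unitInterval} :
    sampleIndex Q r w = i
      ↔ w ∈ firstAccept Q r i ∨ (i = 0 ∧ ∀ j, w j ∉ accept Q r j) := by
  constructor
  · rintro rfl
    by_cases h : ∃ j, w j ∈ accept Q r j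
    · exact Or.inl ⟨fun j hj => Nat.notMem_of_lt_sInf hj,
        Nat.sInf_mem (s := {i | w i ∈ accept Q r i}) h⟩
    · push Not at h
      exact Or.inr ⟨by simp [sampleIndex, h], h⟩
  · rintro (h | ⟨rfl, h⟩)
    · exact sampleIndex_eq h
    · simp [sampleIndex, h]

theorem disjoint_firstAccept (Q : Measure α) (r : α → ℝ≥0∞) :
    Pairwise (Function.onFun Disjoint (firstAccept Q r)) := fun _ _ hij =>
  Set.disjoint_left.mpr fun _ hi hj => hij ((sampleIndex_eq hi).symm.trans (sampleIndex_eq hj))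

variable {Q : Measure α} {r : α → ℝ≥0∞}

theorem measurableSet_accept (hr : Measurable r) (i : ℕ) : MeasurableSet (accept Q r i) :=
  measurableSet_lt (measurable_const.add (measurable_const.mul
    (measurable_subtype_coe.comp measurable_snd).ennreal_ofReal)) (hr.comp measurable_fst)

theorem measurableSet_firstAccept (hr : Measurable r) (i : ℕ) :
    MeasurableSet (firstAccept Q r i) := by
  have : firstAccept Q r i = (⋂ j, ⋂ (_ : j < i), {w | w j ∈ (accept Q r j)ᶜ})
      ∩ {w | w i ∈ accept Q r i} := by
    ext w
    simp [firstAccept]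
  rw [this]
  exact (MeasurableSet.iInter fun j => MeasurableSet.iInter fun _ =>
    measurable_pi_apply j (measurableSet_accept hr j).compl).inter
    (measurable_pi_apply i (measurableSet_accept hr i))

theorem mul_accept_add (hr : Measurable r) (i : ℕ) {B : Set α} (hB : MeasurableSet B) :
    (1 - cappedMass Q r (level Q r i))
        * (Q.prod volume) (accept Q r i ∩ Prod.fst ⁻¹' B)
      + ∫⁻ z in B, min (r z) (level Q r i) ∂Q
      = ∫⁻ z in B, min (r z) (level Q r (i + 1)) ∂Q := by
  set s := 1 - cappedMass Q r (level Q r i) with hs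
  have hst : s ≠ ∞ := ne_top_of_le_ne_top ENNReal.one_ne_top tsub_le_self
  have hmB : MeasurableSet (Prod.fst ⁻¹' B : Set (α × unitInterval)) := measurable_fst hB
  have hm := (measurableSet_accept (Q := Q) hr i).inter hmB
  have hslice : ∀ z, volume (Prod.mk z ⁻¹' (accept Q r i ∩ Prod.fst ⁻¹' B))
      = B.indicator (fun z => volume {v : unitInterval |
          level Q r i + s * ENNReal.ofReal v < r z}) z := by
    intro z
    by_cases hz : z ∈ B
    · rw [Set.indicator_of_mem hz]
      congr 1
      ext v
      simp [accept, hz, hs]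
    · rw [Set.indicator_of_notMem hz]
      convert measure_empty (μ := (volume : Measure unitInterval))
      ext v
      simp [hz]
  rw [Measure.prod_apply hm]
  simp_rw [hslice]
  rw [lintegral_indicator hB, ← lintegral_const_mul' _ _ hst,
    ← lintegral_add_right _ (hr.min measurable_const)]
  exact lintegral_congr fun z => mul_volume_layer_add hst

variable [IsProbabilityMeasure Q]

instance : IsProbabilityMeasure (proposalLaw Q) := by
  unfold proposalLaw
  infer_instance

/-- The probability that the first `i` proposals are rejected is the mass still missing. -/
theorem prod_reject (hr : Measurable r) (hr1 : ∫⁻ z, r z ∂Q = 1) (i : ℕ) :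
    ∏ j ∈ Finset.range i, (Q.prod volume) (accept Q r j)ᶜ
      = 1 - cappedMass Q r (level Q r i) := by
  induction i with
  | zero => simp [level, cappedMass_zero]
  | succ i ih =>
    have h := mul_accept_add (Q := Q) hr i MeasurableSet.univ
    simp only [Set.preimage_univ, Set.inter_univ, Measure.restrict_univ] at h
    have hF : cappedMass Q r (level Q r i) ≤ 1 := hr1 ▸ cappedMass_le_lintegral Q r _
    rw [Finset.prod_range_succ, ih, prob_compl_eq_one_sub (measurableSet_accept hr i),
      ENNReal.mul_sub fun _ _ => ne_top_of_le_ne_top ENNReal.one_ne_top tsub_le_self, mul_one,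
      tsub_tsub, add_comm]
    congr 1

/-- In round `i`, greedy rejection sampling outputs the part of the target that lies in the `i`-th
layer. -/
theorem proposalLaw_firstAccept_add (hr : Measurable r) (hr1 : ∫⁻ z, r z ∂Q = 1) (i : ℕ)
    {B : Set α} (hB : MeasurableSet B) :
    proposalLaw Q (firstAccept Q r i ∩ {w | (w i).1 ∈ B})
      + ∫⁻ z in B, min (r z) (level Q r i) ∂Q
      = ∫⁻ z in B, min (r z) (level Q r (i + 1)) ∂Q := by
  have hset : firstAccept Q r i ∩ {w | (w i).1 ∈ B}
      = (Finset.range (i + 1) : Set ℕ).pi fun j =>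
          if j < i then (accept Q r j)ᶜ else accept Q r j ∩ Prod.fst ⁻¹' B := by
    ext w
    simp only [firstAccept, Set.mem_inter_iff, Set.mem_ofPred_eq, Set.mem_pi, Finset.coe_range,
      Set.mem_Iio]
    constructor
    · rintro ⟨⟨h1, h2⟩, h3⟩ j hj
      rcases Nat.lt_succ_iff_lt_or_eq.mp hj with h | rfl
      · rw [if_pos h]
        exact h1 j h
      · rw [if_neg (lt_irrefl _)]
        exact ⟨h2, h3⟩
    · intro h
      have hi := h i (Nat.lt_succ_self i)
      rw [if_neg (lt_irrefl _)] at hi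
      refine ⟨⟨fun j hj => ?_, hi.1⟩, hi.2⟩
      have hj' := h j (hj.trans (Nat.lt_succ_self i))
      rw [if_pos hj] at hj'
      exact hj'
  have hmB : MeasurableSet (Prod.fst ⁻¹' B : Set (α × unitInterval)) := measurable_fst hB
  rw [hset, proposalLaw, Measure.infinitePi_pi, Finset.prod_range_succ, if_neg (lt_irrefl _),
    Finset.prod_congr rfl fun j hj => by rw [if_pos (Finset.mem_range.mp hj)],
    prod_reject hr hr1, mul_accept_add hr i hB]
  intro j _
  split_ifs
  · exact (measurableSet_accept hr j).compl
  · exact (measurableSet_accept hr j).inter hmB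

theorem sum_proposalLaw_firstAccept (hr : Measurable r) (hr1 : ∫⁻ z, r z ∂Q = 1) (n : ℕ)
    {B : Set α} (hB : MeasurableSet B) :
    ∑ i ∈ Finset.range n, proposalLaw Q (firstAccept Q r i ∩ {w | (w i).1 ∈ B})
      = ∫⁻ z in B, min (r z) (level Q r n) ∂Q := by
  induction n with
  | zero => simp [level]
  | succ n ih => rw [Finset.sum_range_succ, ih, add_comm, proposalLaw_firstAccept_add hr hr1 n hB]

theorem proposalLaw_firstAccept (hr : Measurable r) (hr1 : ∫⁻ z, r z ∂Q = 1) (i : ℕ) :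
    proposalLaw Q (firstAccept Q r i)
      = cappedMass Q r (level Q r (i + 1)) - cappedMass Q r (level Q r i) := by
  have h := proposalLaw_firstAccept_add (Q := Q) hr hr1 i MeasurableSet.univ
  simp only [Set.mem_univ, Set.ofPred_true, Set.inter_univ, Measure.restrict_univ] at h
  refine ENNReal.eq_sub_of_add_eq ?_ h
  exact ne_top_of_le_ne_top ENNReal.one_ne_top (hr1 ▸ cappedMass_le_lintegral Q r _)

theorem ae_mem_firstAccept (hr : Measurable r) (hr1 : ∫⁻ z, r z ∂Q = 1) :
    ∀ᵐ w ∂(proposalLaw Q), ∃ i, w ∈ firstAccept Q r i := by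
  have hU : proposalLaw Q (⋃ i, firstAccept Q r i) = 1 := by
    rw [measure_iUnion (disjoint_firstAccept Q r) (measurableSet_firstAccept hr),
      ENNReal.tsum_eq_iSup_nat, ← iSup_cappedMass_level hr hr1]
    refine iSup_congr fun n => ?_
    have := sum_proposalLaw_firstAccept (Q := Q) hr hr1 n MeasurableSet.univ
    simpa [cappedMass] using this
  have := (prob_compl_eq_zero_iff (MeasurableSet.iUnion (measurableSet_firstAccept hr))).mpr hU
  filter_upwards [compl_mem_ae_iff.mpr this] with w hw
  simpa using hw

theorem proposalLaw_output_le (hr : Measurable r) (hr1 : ∫⁻ z, r z ∂Q = 1)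
    {B : Set α} (hB : MeasurableSet B) :
    proposalLaw Q {w | (w (sampleIndex Q r w)).1 ∈ B} ≤ ∫⁻ z in B, r z ∂Q := by
  calc proposalLaw Q {w | (w (sampleIndex Q r w)).1 ∈ B}
      ≤ proposalLaw Q (⋃ i, firstAccept Q r i ∩ {w | (w i).1 ∈ B}) := by
        refine measure_mono_ae ?_
        filter_upwards [ae_mem_firstAccept hr hr1] with w ⟨i, hi⟩ hw
        have hw : (w (sampleIndex Q r w)).1 ∈ B := hw
        rw [sampleIndex_eq hi] at hw
        exact Set.mem_iUnion.mpr ⟨i, hi, hw⟩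
    _ ≤ ∑' i, proposalLaw Q (firstAccept Q r i ∩ {w | (w i).1 ∈ B}) := measure_iUnion_le _
    _ ≤ ∫⁻ z in B, r z ∂Q := by
        rw [ENNReal.tsum_eq_iSup_nat]
        refine iSup_le fun n => ?_
        rw [sum_proposalLaw_firstAccept hr hr1 n hB]
        exact lintegral_mono fun z => min_le_left _ _

/-- Greedy rejection sampling is exact: its output has density `r` with respect to the law of the
proposals. -/
theorem proposalLaw_output (hr : Measurable r) (hr1 : ∫⁻ z, r z ∂Q = 1)
    {B : Set α} (hB : MeasurableSet B) :
    proposalLaw Q {w | (w (sampleIndex Q r w)).1 ∈ B} = ∫⁻ z in B, r z ∂Q := by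
  refine le_antisymm (proposalLaw_output_le hr hr1 hB) ?_
  have hc := proposalLaw_output_le (Q := Q) hr hr1 hB.compl
  have hfin : ∫⁻ z in Bᶜ, r z ∂Q ≠ ∞ := by
    refine ne_top_of_le_ne_top ENNReal.one_ne_top ?_
    rw [← hr1]
    exact setLIntegral_le_lintegral _ _
  refine (ENNReal.add_le_add_iff_right hfin).mp ?_
  calc ∫⁻ z in B, r z ∂Q + ∫⁻ z in Bᶜ, r z ∂Q = 1 := by rw [lintegral_add_compl _ hB, hr1]
    _ = proposalLaw Q Set.univ := measure_univ.symm
    _ ≤ proposalLaw Q {w | (w (sampleIndex Q r w)).1 ∈ B}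
        + proposalLaw Q {w | (w (sampleIndex Q r w)).1 ∈ Bᶜ} := by
        refine (measure_mono fun w _ => ?_).trans (measure_union_le _ _)
        exact Classical.em _
    _ ≤ _ := by gcongr

end Sampler

section Measurability

variable {β α : Type*} [MeasurableSpace β] [MeasurableSpace α] {Q : Measure α}
  [IsProbabilityMeasure Q] {r : β → α → ℝ≥0∞}

theorem measurable_cappedMass_param (hr : Measurable (Function.uncurry r)) {t : β → ℝ≥0∞}
    (ht : Measurable t) : Measurable fun x => cappedMass Q (r x) (t x) :=
  Measurable.lintegral_prod_right' (f := fun p : β × α => min (r p.1 p.2) (t p.1))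
    (hr.min (ht.comp measurable_fst))

theorem measurable_level_param (hr : Measurable (Function.uncurry r)) (i : ℕ) :
    Measurable fun x => level Q (r x) i := by
  induction i with
  | zero => exact measurable_const
  | succ i ih => exact ih.add (measurable_const.sub (measurable_cappedMass_param hr ih))

theorem measurableSet_mem_accept (hr : Measurable (Function.uncurry r)) (i : ℕ) :
    MeasurableSet {p : β × (ℕ → α × unitInterval) | p.2 i ∈ accept Q (r p.1) i} := by
  have hw : Measurable fun p : β × (ℕ → α × unitInterval) => p.2 i :=
    (measurable_pi_apply i).comp measurable_snd
  have hL := measurable_level_param (Q := Q) hr i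
  have hs : Measurable fun x => 1 - cappedMass Q (r x) (level Q (r x) i) :=
    measurable_const.sub (measurable_cappedMass_param hr hL)
  exact measurableSet_lt ((hL.comp measurable_fst).add ((hs.comp measurable_fst).mul
    (measurable_subtype_coe.comp (measurable_snd.comp hw)).ennreal_ofReal))
    (hr.comp (measurable_fst.prodMk (measurable_fst.comp hw)))

theorem measurableSet_sampleIndex_eq (hr : Measurable (Function.uncurry r)) (i : ℕ) :
    MeasurableSet {p : β × (ℕ → α × unitInterval) | sampleIndex Q (r p.1) p.2 = i} := by
  have hA := measurableSet_mem_accept (Q := Q) hr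
  have : {p : β × (ℕ → α × unitInterval) | sampleIndex Q (r p.1) p.2 = i}
      = ((⋂ j, ⋂ (_ : j < i), {p : β × (ℕ → α × unitInterval) | p.2 j ∈ accept Q (r p.1) j}ᶜ)
          ∩ {p | p.2 i ∈ accept Q (r p.1) i})
        ∪ (⋂ j, ⋂ (_ : i = 0),
            {p : β × (ℕ → α × unitInterval) | p.2 j ∈ accept Q (r p.1) j}ᶜ) ∩ {_p | i = 0} := by
    ext p
    simp only [Set.mem_ofPred_eq, sampleIndex_eq_iff, firstAccept, Set.mem_union,
      Set.mem_inter_iff, Set.mem_iInter, Set.mem_compl_iff]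
    tauto
  rw [this]
  exact ((MeasurableSet.iInter fun j => MeasurableSet.iInter fun _ => (hA j).compl).inter
    (hA i)).union ((MeasurableSet.iInter fun j => MeasurableSet.iInter fun _ =>
      (hA j).compl).inter (MeasurableSet.const _))

end Measurability

/-! ### The scheme built from the sampler -/

section Scheme

variable {𝒳 𝒴 𝒵 : Type u} [MeasurableSpace 𝒳] [MeasurableSpace 𝒴] [MeasurableSpace 𝒵]

/-- The scheme that simulates the channel with densities `r x` by greedy rejection sampling from the
common randomness, and describes the index of the accepted proposal by a Rice code. -/
noncomputable def greedyScheme (Q : Measure 𝒵) [IsProbabilityMeasure Q] (r : 𝒳 → 𝒵 → ℝ≥0∞)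
    (hr : Measurable (Function.uncurry r)) (j : ℕ) : Scheme 𝒳 𝒵 where
  𝒲 := ℕ → 𝒵 × unitInterval
  law := proposalLaw Q
  desc x w := riceCode j (sampleIndex Q (r x) w)
  est m w := (w (Function.invFun (riceCode j) m)).1
  measurableSet_desc m := by
    by_cases hm : ∃ i, riceCode j i = m
    · obtain ⟨i, rfl⟩ := hm
      simp only [(riceCode_injective j).eq_iff]
      exact measurableSet_sampleIndex_eq hr i
    · have : {p : 𝒳 × (ℕ → 𝒵 × unitInterval) | riceCode j (sampleIndex Q (r p.1) p.2) = m} = ∅ := by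
        push Not at hm
        ext p
        simp [hm]
      rw [this]
      exact MeasurableSet.empty
  measurable_est m := measurable_fst.comp (measurable_pi_apply _)
  prefixFree w := (prefixFree_range_riceCode j).mono (by
    rintro _ ⟨x, rfl⟩
    exact ⟨_, rfl⟩)

variable {Q : Measure 𝒵} [IsProbabilityMeasure Q] {r : 𝒳 → 𝒵 → ℝ≥0∞}

theorem channel_greedyScheme_apply (hr : Measurable (Function.uncurry r)) (j : ℕ) {x : 𝒳}
    (hr1 : ∫⁻ z, r x z ∂Q = 1) {C : Set 𝒵} (hC : MeasurableSet C) :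
    (greedyScheme Q r hr j).channel x C = ∫⁻ z in C, r x z ∂Q := by
  rw [Scheme.channel_apply _ _ hC,
    ← proposalLaw_output (r := r x) (hr.comp measurable_prodMk_left) hr1 hC]
  congr 1
  ext w
  simp only [Scheme.output, greedyScheme, Function.leftInverse_invFun (riceCode_injective j) _]

theorem lintegral_length_greedyScheme_le (hr : Measurable (Function.uncurry r)) (j : ℕ) {x : 𝒳}
    (hr1 : ∫⁻ z, r x z ∂Q = 1) :
    ∫⁻ w, (((greedyScheme Q r hr j).desc x w).length : ℝ≥0∞) ∂(greedyScheme Q r hr j).law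
      ≤ ENNReal.ofReal ((1 + (2 ^ j)⁻¹) / Real.log 2)
          * (∫⁻ z, ENNReal.ofReal (InformationTheory.klFun (r x z).toReal) ∂Q + 1)
        + ENNReal.ofReal (1 + j) := by
  have hrx : Measurable (r x) := hr.comp measurable_prodMk_left
  have hlog : 0 < Real.log 2 := Real.log_pos one_lt_two
  set a : ℝ := (1 + (2 ^ j)⁻¹) / Real.log 2 with ha
  have ha0 : 0 ≤ a := by positivity
  have hK : ∀ i, proposalLaw Q {w | sampleIndex Q (r x) w = i}
      = proposalLaw Q (firstAccept Q (r x) i) := by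
    intro i
    refine measure_congr (Filter.eventuallyEq_set.mpr ?_)
    filter_upwards [ae_mem_firstAccept hrx hr1] with w ⟨k, hk⟩
    refine ⟨fun h => ?_, fun h => sampleIndex_eq h⟩
    have h : sampleIndex Q (r x) w = i := h
    rw [sampleIndex_eq hk] at h
    exact h ▸ hk
  have hle : ∀ i : ℕ, ((riceCode j i).length : ℝ≥0∞)
      ≤ ENNReal.ofReal a * ENNReal.ofReal (Real.log (i + 1)) + ENNReal.ofReal (1 + j) := by
    intro i
    have hi0 : 0 ≤ Real.log ((i:ℝ) + 1) :=
      Real.log_nonneg (by linarith [Nat.cast_nonneg (α := ℝ) i])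
    rw [← ENNReal.ofReal_natCast, ← ENNReal.ofReal_mul ha0,
      ← ENNReal.ofReal_add (by positivity) (by positivity)]
    exact ENNReal.ofReal_le_ofReal (length_riceCode_le j i)
  have hms : ∀ i, MeasurableSet {w | sampleIndex Q (r x) w = i} := fun i =>
    (measurable_prodMk_left (x := x)) (measurableSet_sampleIndex_eq hr i)
  calc ∫⁻ w, (((greedyScheme Q r hr j).desc x w).length : ℝ≥0∞) ∂(greedyScheme Q r hr j).law
      ≤ ∫⁻ w, (ENNReal.ofReal a * ENNReal.ofReal (Real.log (sampleIndex Q (r x) w + 1))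
          + ENNReal.ofReal (1 + j)) ∂(proposalLaw Q) := lintegral_mono fun w => hle _
    _ = ENNReal.ofReal a * ∑' i : ℕ, ENNReal.ofReal (Real.log (i + 1))
          * (cappedMass Q (r x) (level Q (r x) (i + 1)) - cappedMass Q (r x) (level Q (r x) i))
        + ENNReal.ofReal (1 + j) := by
        rw [lintegral_add_right _ measurable_const,
          lintegral_const_mul' _ _ ENNReal.ofReal_ne_top,
          lintegral_comp_eq_tsum (proposalLaw Q) hms
            fun i => ENNReal.ofReal (Real.log ((i:ℝ) + 1))]
        simp only [hK, proposalLaw_firstAccept hrx hr1, lintegral_const, measure_univ, mul_one]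
    _ ≤ _ := by
        gcongr
        exact tsum_log_mul_layer_le hrx hr1

end Scheme

/-! ### Simulation of a channel of finite information -/

section Achievability

variable {𝒳 𝒴 𝒵 : Type u} [MeasurableSpace 𝒳] [MeasurableSpace 𝒴] [MeasurableSpace 𝒵]

/-- The risk depends on a channel only through its values, up to null sets, at each fixed event. -/
theorem channelRisk_congr {P : Measure (𝒳 × 𝒴)} [IsProbabilityMeasure P] {κ η : Kernel 𝒳 𝒵}
    [IsMarkovKernel κ] [IsMarkovKernel η]
    (h : ∀ C, MeasurableSet C → ∀ᵐ x ∂P.fst, κ x C = η x C) (loss : 𝒵 → 𝒴 → ℝ) :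
    channelRisk κ loss P = channelRisk η loss P := by
  have heq : P ⊗ₘ (κ.comap Prod.fst measurable_fst : Kernel (𝒳 × 𝒴) 𝒵)
      = P ⊗ₘ (η.comap Prod.fst measurable_fst : Kernel (𝒳 × 𝒴) 𝒵) := by
    refine Measure.ext_prod fun {A C} hA hC => ?_
    rw [Measure.compProd_apply_prod hA hC, Measure.compProd_apply_prod hA hC]
    refine lintegral_congr_ae (ae_restrict_of_ae ?_)
    exact ae_of_ae_map measurable_fst.aemeasurable (h C hC)
  rw [channelRisk, channelRisk, heq]

/-- A channel of finite divergence has densities with respect to its output law, in the weak sense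
that each event has the right probability for almost every input. -/
theorem exists_channel_density {μ : Measure 𝒳} [IsProbabilityMeasure μ] (κ : Kernel 𝒳 𝒵)
    [IsMarkovKernel κ]
    (hfin : InformationTheory.klDiv (μ ⊗ₘ κ) (μ.prod (μ ⊗ₘ κ).snd) ≠ ∞) :
    ∃ r : 𝒳 → 𝒵 → ℝ≥0∞, Measurable (Function.uncurry r) ∧
      (∀ C, MeasurableSet C → ∀ᵐ x ∂μ, ∫⁻ z in C, r x z ∂(μ ⊗ₘ κ).snd = κ x C) ∧
      InformationTheory.klDiv (μ ⊗ₘ κ) (μ.prod (μ ⊗ₘ κ).snd)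
        = ∫⁻ x, ∫⁻ z, ENNReal.ofReal (InformationTheory.klFun (r x z).toReal) ∂(μ ⊗ₘ κ).snd ∂μ := by
  set Q := (μ ⊗ₘ κ).snd with hQ
  have hac : μ ⊗ₘ κ ≪ μ.prod Q := (InformationTheory.klDiv_ne_top_iff.mp hfin).1
  have hrm : Measurable ((μ ⊗ₘ κ).rnDeriv (μ.prod Q)) := Measure.measurable_rnDeriv _ _
  refine ⟨fun x z => (μ ⊗ₘ κ).rnDeriv (μ.prod Q) (x, z), hrm, fun C hC => ?_, ?_⟩
  · refine ae_eq_of_forall_setLIntegral_eq_of_sigmaFinite hrm.lintegral_prod_right'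
      (κ.measurable_coe hC) fun A hA _ => ?_
    rw [← Measure.compProd_apply_prod hA hC, ← Measure.setLIntegral_rnDeriv hac,
      setLIntegral_prod _ hrm.aemeasurable]
  · have hm : Measurable fun p => ENNReal.ofReal
        (InformationTheory.klFun ((μ ⊗ₘ κ).rnDeriv (μ.prod Q) p).toReal) :=
      (InformationTheory.measurable_klFun.comp hrm.ennreal_toReal).ennreal_ofReal
    rw [InformationTheory.klDiv_eq_lintegral_klFun_of_ac hac, lintegral_prod _ hm.aemeasurable]

/-- The achievability bound: every channel of finite information is simulated exactly by a scheme
whose expected description length exceeds the information by at most a logarithmic term. -/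
theorem exists_scheme_rate_le (P : Measure (𝒳 × 𝒴)) [IsProbabilityMeasure P] (κ : Kernel 𝒳 𝒵)
    [IsMarkovKernel κ] (hfin : channelInfo κ P ≠ ∞) :
    ∃ S : Scheme 𝒳 𝒵, (∀ C, MeasurableSet C → ∀ᵐ x ∂P.fst, S.channel x C = κ x C) ∧
      (S.rate P : EReal) ≤ (channelInfo κ P : EReal) + log2 (channelInfo κ P + 1) + 5 := by
  have hlog : 0 < Real.log 2 := Real.log_pos one_lt_two
  have hlog' : ENNReal.ofReal (Real.log 2) ≠ 0 := (ENNReal.ofReal_pos.mpr hlog).ne'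
  set I := (channelInfo κ P).toReal with hI
  have hI0 : 0 ≤ I := ENNReal.toReal_nonneg
  have hInfo : channelInfo κ P = ENNReal.ofReal I := (ENNReal.ofReal_toReal hfin).symm
  have hkl : InformationTheory.klDiv (P.fst ⊗ₘ κ) (P.fst.prod (P.fst ⊗ₘ κ).snd)
      = ENNReal.ofReal (I * Real.log 2) := by
    rw [ENNReal.ofReal_mul hI0, ← hInfo, channelInfo, mutualInfo, Measure.fst_compProd,
      ENNReal.div_mul_cancel hlog' ENNReal.ofReal_ne_top]
  obtain ⟨r, hr, hrκ, hD⟩ := exists_channel_density (μ := P.fst) κ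
    (by rw [hkl]; exact ENNReal.ofReal_ne_top)
  obtain ⟨j, hj⟩ := exists_riceCode_parameter hI0
  have hr1 : ∀ᵐ x ∂P.fst, ∫⁻ z, r x z ∂(P.fst ⊗ₘ κ).snd = 1 := by
    filter_upwards [hrκ Set.univ MeasurableSet.univ] with x hx
    simpa using hx
  refine ⟨greedyScheme (P.fst ⊗ₘ κ).snd r hr j, fun C hC => ?_, ?_⟩
  · filter_upwards [hr1, hrκ C hC] with x hx1 hxC
    rw [channel_greedyScheme_apply hr j hx1 hC, hxC]
  · set a : ℝ := (1 + (2 ^ j)⁻¹) / Real.log 2 with ha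
    have ha0 : 0 ≤ a := by positivity
    have hrate : (greedyScheme (P.fst ⊗ₘ κ).snd r hr j).rate P
        ≤ ENNReal.ofReal (I + Real.log (I + 1) / Real.log 2 + 5) := by
      calc (greedyScheme (P.fst ⊗ₘ κ).snd r hr j).rate P
          ≤ ∫⁻ x, (ENNReal.ofReal a * (∫⁻ z, ENNReal.ofReal
              (InformationTheory.klFun (r x z).toReal) ∂(P.fst ⊗ₘ κ).snd + 1)
              + ENNReal.ofReal (1 + j)) ∂P.fst := by
            rw [Scheme.rate_eq_lintegral]
            refine lintegral_mono_ae ?_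
            filter_upwards [hr1] with x hx1
            exact lintegral_length_greedyScheme_le hr j hx1
        _ = ENNReal.ofReal a * (ENNReal.ofReal (I * Real.log 2) + 1) + ENNReal.ofReal (1 + j) := by
            rw [lintegral_add_right _ measurable_const,
              lintegral_const_mul' _ _ ENNReal.ofReal_ne_top,
              lintegral_add_right _ measurable_const, ← hD, hkl]
            simp
        _ = ENNReal.ofReal (a * (I * Real.log 2 + 1) + (1 + j)) := by
            rw [← ENNReal.ofReal_one, ← ENNReal.ofReal_add (by positivity) zero_le_one,
              ← ENNReal.ofReal_mul ha0, ← ENNReal.ofReal_add (by positivity) (by positivity)]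
        _ ≤ _ := ENNReal.ofReal_le_ofReal hj
    have hl0 : 0 ≤ Real.log (I + 1) := Real.log_nonneg (by linarith)
    have hlog2 : log2 (channelInfo κ P + 1) = ((Real.log (I + 1) / Real.log 2 : ℝ) : EReal) := by
      rw [log2, hInfo, ← ENNReal.ofReal_one, ← ENNReal.ofReal_add hI0 zero_le_one,
        ENNReal.log_ofReal_of_pos (by linarith), EReal.coe_div]
    rw [hlog2, hInfo, EReal.coe_ennreal_ofReal, max_eq_left hI0]
    refine (EReal.coe_ennreal_le_coe_ennreal_iff.mpr hrate).trans ?_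
    rw [EReal.coe_ennreal_ofReal, max_eq_left (by positivity), EReal.coe_add, EReal.coe_add]
    rfl

/-- The upper bound on the minimax cost for a known law. -/
theorem minimaxCost_le_iInf_lagrangian (loss : 𝒵 → 𝒴 → ℝ)
    (hloss : Measurable (Function.uncurry loss)) (lam : ℝ) (hlam : 0 < lam)
    (P : ProbabilityMeasure (𝒳 × 𝒴)) :
    minimaxCost loss lam {P}
      ≤ ⨅ (κ : Kernel 𝒳 𝒵) (_ : IsMarkovKernel κ),
        lagrangian lam (channelRisk κ loss (P : Measure (𝒳 × 𝒴)))
          ((channelInfo κ (P : Measure (𝒳 × 𝒴)) : EReal)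
            + log2 (channelInfo κ (P : Measure (𝒳 × 𝒴)) + 1) + 5) := by
  refine le_iInf₂ fun κ _ => ?_
  by_cases hfin : channelInfo κ (P : Measure (𝒳 × 𝒴)) = ∞
  · -- an infinite rate makes the right-hand side infinite, also when the risk is `⊥`
    have hlog : 0 < Real.log 2 := Real.log_pos one_lt_two
    have hrate : ((∞ : ℝ≥0∞) : EReal) + log2 (∞ + 1) + 5 = ⊤ := by
      rw [log2, top_add, ENNReal.log_top, EReal.top_div_of_pos_ne_top (by exact_mod_cast hlog)
        (EReal.coe_ne_top _), EReal.coe_ennreal_top, EReal.top_add_top]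
      exact EReal.top_add_coe 5
    have hmul : (lam : EReal) * ⊤ = ⊤ := EReal.coe_mul_top_of_pos hlam
    have : lagrangian lam (channelRisk κ loss (P : Measure (𝒳 × 𝒴))) ⊤ = ⊤ := by
      unfold lagrangian
      rw [hmul]
      split_ifs with h
      · rfl
      · exact EReal.add_top_of_ne_bot fun hb => h ⟨hb, rfl⟩
    rw [hfin, hrate, this]
    exact le_top
  · obtain ⟨S, hS, hrate⟩ := exists_scheme_rate_le (P : Measure (𝒳 × 𝒴)) κ hfin
    refine (iInf_le _ S).trans ?_
    rw [iSup_singleton, Scheme.cost, S.risk_eq_channelRisk hloss, channelRisk_congr hS]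
    exact lagrangian_mono hlam _ hrate

end Achievability

end RemotePrediction

theorem theorem1 {𝒳 𝒴 𝒵 : Type u}
    [MeasurableSpace 𝒳] [MeasurableSpace 𝒴] [MeasurableSpace 𝒵]
    (loss : 𝒵 → 𝒴 → ℝ) (hloss : Measurable (Function.uncurry loss))
    (lam : ℝ) (hlam : 0 < lam) (P : ProbabilityMeasure (𝒳 × 𝒴)) :
    (⨅ (κ : Kernel 𝒳 𝒵) (_ : IsMarkovKernel κ),
        lagrangian lam (channelRisk κ loss (P : Measure (𝒳 × 𝒴)))
          (channelInfo κ (P : Measure (𝒳 × 𝒴)) : EReal))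
      ≤ minimaxCost loss lam {P} ∧
    minimaxCost loss lam {P}
      ≤ ⨅ (κ : Kernel 𝒳 𝒵) (_ : IsMarkovKernel κ),
        lagrangian lam (channelRisk κ loss (P : Measure (𝒳 × 𝒴)))
          ((channelInfo κ (P : Measure (𝒳 × 𝒴)) : EReal)
            + log2 (channelInfo κ (P : Measure (𝒳 × 𝒴)) + 1) + 5) :=
  ⟨iInf_lagrangian_le_minimaxCost loss hloss lam hlam P,
    minimaxCost_le_iInf_lagrangian loss hloss lam hlam P⟩
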